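/- \textbf{Setting.} Let $G=(V,E)$ be a finite graph with edge costs $c_e\ge 0$, let $\mathcal D$ be a finite collection of demand pairs of vertices, and let $\varepsilon>0$. A \emph{solution} is a set $F\subseteq E$ such that both vertices of each demand pair lie in the same component of $(V,F)$. Assume that a solution exists, and let $\mathrm{OPT}$ be a solution of minimum total cost $c(\mathrm{OPT})$. A set $U\subseteq V$ \emph{separates} a pair if it contains exactly one of its two vertices; $\delta(U)$ is the set of edges separated by $U$, and $\mathrm{sep}(U)\subseteq\mathcal D$ is the set of demand pairs separated by $U$. \textbf{The $\varepsilon$-extended moat-growing algorithm.} Start at time $t=0$ with $y_S=0$ for all $S\subseteq V$ and all budgets $0$. An edge $e$ is tight if $\sum_{S:\,e\in\delta(S)}y_S=c_e$, and $\mathcal C^t$ is the set of connected components formed by the edges that are tight at time $t$. A component is \emph{demand-active} if it contains a vertex that is not in the same component as one of its partners in $\mathcal D$, and \emph{budget-active} if it is not demand-active but has positive budget; $\mathcal A^t\subseteq\mathcal C^t$ is the set of components that are active in one of these two ways. While time grows at unit rate, $y_S$ grows at unit rate for every $S\in\mathcal A^t$ and all other $y_S$ stay constant; the budget of a demand-active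 component grows at rate $\varepsilon$ and the budget of a budget-active component decreases at rate $1$. When components are merged by newly tight edges, their budgets are added. Let $y$ be the final vector, $\mathrm{supp}(y)=\{U:y_U>0\}$, $\mathcal U_{\rm sep}=\{U\in\mathrm{supp}(y):\mathrm{sep}(U)\ne\emptyset\}$, $y(\mathcal U_{\rm sep})=\sum_{U\in\mathcal U_{\rm sep}}y_U$, and $\mathrm{excess}(\mathrm{OPT})=c(\mathrm{OPT})-y(\mathcal U_{\rm sep})$. \textbf{Actively connected sets.} The \emph{deactivation time} of a vertex $v$ is the largest $t$ such that $v$ lies in a member of $\mathcal A^s$ for all $0\le s<t$. Vertices $u,v$ are \emph{actively connected} if there is a time $t\ge0$ such that $u,v$ lie in a common member of $\mathcal C^t$ and both have deactivation time at least $t$. This is an equivalence relation; a set $S\subseteq V$ is actively connected if it is contained in one of its classes. Let $\mathrm{cost}(S)$ be the minimum cost of an edge set $F\subseteq E$ such that all of $S$ lies in one component of $(V,F)$. For a collection $\mathcal S$ of actively connected sets let $\mathrm{cost}(\mathcal S)=\sum_{S\in\mathcal S}\mathrm{cost}(S)$ and $$\mathrm{gain}(\mathcal S)=2\int_0^\infty\big(|\mathcal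 A^t|-|\mathcal A^t/\mathcal S|\big)\,dt,$$ where $\mathcal A^t/\mathcal S$ arises from $\mathcal A^t$ by merging sets whenever they are intersected by the same $S\in\mathcal S$. \textbf{Autarkic collections.} An \emph{autarkic pair} is a set $\{A,B\}$ of two disjoint sets in $\mathrm{supp}(y)$ with $A,B\in\mathcal A^t$ for some $t$ and $\mathrm{sep}(A)=\mathrm{sep}(B)\neq\emptyset$. An \emph{autarkic triple} is a set $\{A_1,A_2,A_3\}$ of pairwise disjoint sets with $A_1,A_2,A_3\in\mathcal A^t$ for some $t$, $\mathrm{sep}(A_i)\ne\emptyset$ for each $i$, and $\mathrm{sep}(A_1\cup A_2\cup A_3)=\emptyset$. For such a tuple $P$ let $\mathrm{sep}(P)=\bigcup_{A\in P}\mathrm{sep}(A)$. An \emph{autarkic collection} $\mathcal P$ is a set of autarkic pairs and triples; it is \emph{crossing-free} if $\mathrm{sep}(P)\cap\mathrm{sep}(Q)=\emptyset$ for all distinct $P,Q\in\mathcal P$. Let $\mathrm{coverage}(\mathcal P)$ be the sum of $y_U$ over all $U\in\mathrm{supp}(y)$ such that $\mathrm{sep}(U)=\mathrm{sep}(A)$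 for some $A\in P\in\mathcal P$. For each $P\in\mathcal P$ and each two distinct $A,B\in P$ with $\mathrm{sep}(A)\cap\mathrm{sep}(B)\neq\emptyset$, choose an arbitrary demand pair in $\mathrm{sep}(A)\cap\mathrm{sep}(B)$ as a \emph{designated representative}; $\mathrm{cost}(P)$ is the minimum cost of an edge set connecting all endpoints of the designated representatives of $P$ with each other (for a pair, the length of a shortest path between the two vertices of its representative), and $\mathrm{cost}(\mathcal P)=\sum_{P\in\mathcal P}\mathrm{cost}(P)$. \textbf{Theorem.} There exist a collection $\mathcal S$ of actively connected vertex sets and a crossing-free autarkic collection $\mathcal P$ such that, for every choice of the designated representatives, $$\frac{10}{3}\big(\mathrm{gain}(\mathcal S)-\mathrm{cost}(\mathcal S)\big)+\big(2\,\mathrm{coverage}(\mathcal P)-\mathrm{cost}(\mathcal P)\big)+\Big(\frac1{2\varepsilon}+17\Big)\,\mathrm{excess}(\mathrm{OPT})\ \ge\ y(\mathcal U_{\rm sep}).$$ -/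

import Mathlib

/-- An instance of the Steiner forest problem on the vertex set `V`: a graph, nonnegative edge
costs, and a collection of demand pairs. -/
structure SteinerForestInstance (V : Type*) where
  graph : SimpleGraph V
  cost : Sym2 V → ℝ
  cost_nonneg : ∀ e ∈ graph.edgeSet, 0 ≤ cost e
  demands : Finset (Sym2 V)

namespace SteinerForestInstance

noncomputable section

open scoped Classical

variable {V : Type*} [Fintype V]

/-! ### Solutions, cuts, Steiner trees -/

/-- `u` and `v` lie in the same connected component of the graph `(V, F)`. -/
def Linked (F : Finset (Sym2 V)) (u v : V) : Prop :=
  (SimpleGraph.fromEdgeSet (F : Set (Sym2 V))).Reachable u v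

/-- The vertex sets of the connected components of the graph `(V, F)`. -/
def components (F : Finset (Sym2 V)) : Finset (Finset V) :=
  Finset.univ.image fun v => Finset.univ.filter fun u => Linked F v u

/-- The set `U` separates the pair `d`: one member of `d` is in `U`, another one is not. -/
def Separates (U : Finset V) (d : Sym2 V) : Prop :=
  (∃ a ∈ d, a ∈ U) ∧ (∃ b ∈ d, b ∉ U)

variable (I : SteinerForestInstance V)

/-- The edge set `E` of the graph. -/
def edges : Finset (Sym2 V) := Finset.univ.filter fun e => e ∈ I.graph.edgeSet

/-- The cut `δ(U)`: the edges with exactly one endpoint in `U`. -/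
def cut (U : Finset V) : Finset (Sym2 V) := I.edges.filter fun e => Separates U e

/-- The total cost `c(F)` of an edge set. -/
def totalCost (F : Finset (Sym2 V)) : ℝ := ∑ e ∈ F, I.cost e

/-- `F` is a solution: a set of edges that connects every demand pair. -/
def IsSolution (F : Finset (Sym2 V)) : Prop :=
  F ⊆ I.edges ∧ ∀ a b : V, s(a, b) ∈ I.demands → Linked F a b

/-- `F` is a solution of minimum total cost. -/
def IsOptimal (F : Finset (Sym2 V)) : Prop :=
  I.IsSolution F ∧ ∀ F', I.IsSolution F' → I.totalCost F ≤ I.totalCost F'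

/-- The minimum cost of a set of edges that connects all vertices of `S` with each other. (The
infimum is over a finite set, which is nonempty if `S` lies in one component of the graph.) -/
def steinerCost (S : Finset V) : ℝ :=
  sInf {x | ∃ F ⊆ I.edges, (∀ u ∈ S, ∀ v ∈ S, Linked F u v) ∧ x = I.totalCost F}

/-- The cost of a collection of vertex sets. -/
def collectionCost (𝒮 : Finset (Finset V)) : ℝ := ∑ S ∈ 𝒮, I.steinerCost S

/-- `sep(U)`: the demand pairs that `U` separates. -/
def sep (U : Finset V) : Finset (Sym2 V) := I.demands.filter fun d => Separates U d

/-! ### The `ε`-extended moat-growing algorithm -/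

/-- A snapshot of the algorithm: the current time, the dual variables `y_S`, and the budgets `b_S`
(the values `b_S` matter only for the current components `S`). -/
structure State (V : Type*) where
  time : ℝ
  y : Finset V → ℝ
  budget : Finset V → ℝ

/-- The initial snapshot. -/
def initial : State V := ⟨0, fun _ => 0, fun _ => 0⟩

/-- The left-hand side of the dual constraint of the edge `e`. -/
def load (y : Finset V → ℝ) (e : Sym2 V) : ℝ :=
  ∑ S ∈ Finset.univ.filter (fun S => e ∈ I.cut S), y S

/-- The tight edges. -/
def tightEdges (σ : State V) : Finset (Sym2 V) :=
  I.edges.filter fun e => I.load σ.y e = I.cost e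

/-- The current components: the connected components of the graph formed by the tight edges. -/
def comps (σ : State V) : Finset (Finset V) := components (I.tightEdges σ)

/-- The demand-active components: those containing a terminal that is not connected to one of its
partners. -/
def demandActive (σ : State V) : Finset (Finset V) :=
  (I.comps σ).filter fun S => ∃ a ∈ S, ∃ b, s(a, b) ∈ I.demands ∧ ¬ Linked (I.tightEdges σ) a b

/-- The budget-active components: not demand-active, but with positive budget. -/
def budgetActive (σ : State V) : Finset (Finset V) :=
  (I.comps σ).filter fun S => S ∉ I.demandActive σ ∧ 0 < σ.budget S

/-- The active components. -/
def active (σ : State V) : Finset (Finset V) := I.demandActive σ ∪ I.budgetActive σ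

/-- The rate at which the load of the edge `e` grows. -/
def rate (σ : State V) (e : Sym2 V) : ℕ := ((I.active σ).filter fun S => e ∈ I.cut S).card

/-- The waiting times until the possible next events, if the active components do not change
before: an edge that is not tight becomes tight, or a budget-active component uses up its budget. -/
def waits (σ : State V) : Finset ℝ :=
  ((I.edges.filter fun e => e ∉ I.tightEdges σ ∧ 0 < I.rate σ e).image
      fun e => (I.cost e - I.load σ.y e) / I.rate σ e) ∪
    (I.budgetActive σ).image σ.budget

/-- The budget of the current component `S` after all active components have grown for `Δ` time
units: a demand-active component earns at rate `ε`, a budget-active one pays at rate `1`. -/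
def grownBudget (ε : ℝ) (σ : State V) (Δ : ℝ) (S : Finset V) : ℝ :=
  σ.budget S +
    if S ∈ I.demandActive σ then ε * Δ else if S ∈ I.budgetActive σ then -Δ else 0

/-- The snapshot after all active components have grown for `Δ` time units. The budget of a set is
the sum of the budgets of the previous components that it contains; for a new component, these are
the components that have been merged into it. -/
def grow (ε : ℝ) (σ : State V) (Δ : ℝ) : State V where
  time := σ.time + Δ
  y S := σ.y S + if S ∈ I.active σ then Δ else 0
  budget S := ∑ S' ∈ (I.comps σ).filter (fun S' => S' ⊆ S), I.grownBudget ε σ Δ S'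

/-- Proceed to the next event, if there is one. -/
def step (ε : ℝ) (σ : State V) : State V :=
  if h : (I.waits σ).Nonempty then I.grow ε σ ((I.waits σ).min' h) else σ

/-- The snapshot right after the `k`-th event (the final one, if there are fewer events). -/
def state (ε : ℝ) (k : ℕ) : State V := (I.step ε)^[k] initial

/-- The time `t` belongs to the phase that starts with the `k`-th event: it is not earlier than
that event, and earlier than the next one, if there is a next one. -/
def InPhase (ε : ℝ) (k : ℕ) (t : ℝ) : Prop :=
  (I.state ε k).time ≤ t ∧
    ((I.waits (I.state ε k)).Nonempty → t < (I.state ε (k + 1)).time)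

/-- The components `𝒞ᵗ` at time `t`. -/
def compsAt (ε t : ℝ) : Finset (Finset V) :=
  Finset.univ.filter fun S => ∃ k, I.InPhase ε k t ∧ S ∈ I.comps (I.state ε k)

/-- The active components `𝒜ᵗ` at time `t`. -/
def activeAt (ε t : ℝ) : Finset (Finset V) :=
  Finset.univ.filter fun S => ∃ k, I.InPhase ε k t ∧ S ∈ I.active (I.state ε k)

/-- The dual solution `y` that the algorithm generates: the final values of the dual variables,
which never decrease and are constant after finitely many events. -/
def dual (ε : ℝ) (S : Finset V) : ℝ := ⨆ k, (I.state ε k).y S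

/-- The support of the dual solution. -/
def support (ε : ℝ) : Finset (Finset V) := Finset.univ.filter fun U => 0 < I.dual ε U

/-- The sets in the support that separate some demand pair. -/
def sepSupport (ε : ℝ) : Finset (Finset V) := (I.support ε).filter fun U => (I.sep U).Nonempty

/-- The value `y(𝒰_sep)`. -/
def sepValue (ε : ℝ) : ℝ := ∑ U ∈ I.sepSupport ε, I.dual ε U

/-- The excess of a solution with respect to the dual solution. -/
def excess (ε : ℝ) (F : Finset (Sym2 V)) : ℝ := I.totalCost F - I.sepValue ε

/-! ### Actively connected sets and their gain -/

/-- The deactivation time of `v`: the largest `t` such that `v` is in an active component at all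
times before `t`. (Bounded whenever the instance has a solution.) -/
def deactivationTime (ε : ℝ) (v : V) : ℝ :=
  sSup {t | 0 ≤ t ∧ ∀ s, 0 ≤ s → s < t → ∃ S ∈ I.activeAt ε s, v ∈ S}

/-- The vertices `u` and `v` are actively connected. -/
def ActivelyConnected (ε : ℝ) (u v : V) : Prop :=
  ∃ t, 0 ≤ t ∧ (∃ S ∈ I.compsAt ε t, u ∈ S ∧ v ∈ S) ∧
    t ≤ I.deactivationTime ε u ∧ t ≤ I.deactivationTime ε v

/-- The set `S` is contained in a class of the relation of being actively connected. -/
def ActivelyConnectedSet (ε : ℝ) (S : Finset V) : Prop :=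
  ∃ v, ∀ u ∈ S, I.ActivelyConnected ε v u

/-- The graph on a family `𝒜` of vertex sets in which two sets are adjacent if they are intersected
by the same member of `𝒮`. -/
def mergeGraph (𝒜 𝒮 : Finset (Finset V)) : SimpleGraph {A // A ∈ 𝒜} :=
  SimpleGraph.fromRel fun A B => ∃ S ∈ 𝒮, (S ∩ A.1).Nonempty ∧ (S ∩ B.1).Nonempty

/-- The number `|𝒜 / 𝒮|` of sets that remain of `𝒜` after merging sets whenever they are
intersected by the same member of `𝒮`. -/
def mergedCount (𝒜 𝒮 : Finset (Finset V)) : ℕ := Nat.card (mergeGraph 𝒜 𝒮).ConnectedComponent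

/-- The gain of a collection of vertex sets. -/
def gain (ε : ℝ) (𝒮 : Finset (Finset V)) : ℝ :=
  2 * ∫ t in Set.Ioi (0 : ℝ),
    (((I.activeAt ε t).card : ℝ) - (mergedCount (I.activeAt ε t) 𝒮 : ℝ))

/-! ### Autarkic collections -/

/-- Autarkic pairs. -/
def IsAutarkicPair (ε : ℝ) (P : Finset (Finset V)) : Prop :=
  ∃ A B, P = {A, B} ∧ A ∈ I.support ε ∧ B ∈ I.support ε ∧ Disjoint A B ∧
    (∃ t, 0 ≤ t ∧ A ∈ I.activeAt ε t ∧ B ∈ I.activeAt ε t) ∧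
    I.sep A = I.sep B ∧ (I.sep A).Nonempty

/-- Autarkic triples. -/
def IsAutarkicTriple (ε : ℝ) (P : Finset (Finset V)) : Prop :=
  ∃ A₁ A₂ A₃, P = {A₁, A₂, A₃} ∧ Disjoint A₁ A₂ ∧ Disjoint A₁ A₃ ∧ Disjoint A₂ A₃ ∧
    (∃ t, 0 ≤ t ∧ A₁ ∈ I.activeAt ε t ∧ A₂ ∈ I.activeAt ε t ∧ A₃ ∈ I.activeAt ε t) ∧
    (I.sep A₁).Nonempty ∧ (I.sep A₂).Nonempty ∧ (I.sep A₃).Nonempty ∧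
    I.sep (A₁ ∪ A₂ ∪ A₃) = ∅

/-- Collections of autarkic tuples. -/
def IsAutarkicCollection (ε : ℝ) (𝒬 : Finset (Finset (Finset V))) : Prop :=
  ∀ P ∈ 𝒬, I.IsAutarkicPair ε P ∨ I.IsAutarkicTriple ε P

/-- The demand pairs separated by some member of the tuple `P`. -/
def tupleSep (P : Finset (Finset V)) : Finset (Sym2 V) := P.biUnion I.sep

/-- Distinct tuples of the collection separate no common demand pair. -/
def CrossingFree (𝒬 : Finset (Finset (Finset V))) : Prop :=
  ∀ P ∈ 𝒬, ∀ Q ∈ 𝒬, P ≠ Q → Disjoint (I.tupleSep P) (I.tupleSep Q)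

/-- The set `U` in the support is covered by the collection. -/
def Covers (ε : ℝ) (𝒬 : Finset (Finset (Finset V))) (U : Finset V) : Prop :=
  U ∈ I.support ε ∧ ∃ P ∈ 𝒬, ∃ A ∈ P, I.sep A = I.sep U

/-- The total dual value of the covered sets. -/
def coverage (ε : ℝ) (𝒬 : Finset (Finset (Finset V))) : ℝ :=
  ∑ U ∈ Finset.univ.filter (fun U => I.Covers ε 𝒬 U), I.dual ε U

/-- `rep` picks designated representatives for the tuples in `𝒬`: for each tuple `P` and each two
distinct members `A`, `B` of `P` that separate a common demand pair, `rep P s(A, B)` is such a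
demand pair. For an autarkic pair `P = {A, B}` this is a single element of
`sep(P) = sep(A) = sep(B)`. -/
def IsRepresentative (𝒬 : Finset (Finset (Finset V)))
    (rep : Finset (Finset V) → Sym2 (Finset V) → Sym2 V) : Prop :=
  ∀ P ∈ 𝒬, ∀ A ∈ P, ∀ B ∈ P, A ≠ B → (I.sep A ∩ I.sep B).Nonempty →
    rep P s(A, B) ∈ I.sep A ∩ I.sep B

/-- The endpoints of the designated representatives of the tuple `P`. -/
def connectorTerminals (rep : Finset (Finset V) → Sym2 (Finset V) → Sym2 V)
    (P : Finset (Finset V)) : Finset V :=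
  Finset.univ.filter fun v => ∃ A ∈ P, ∃ B ∈ P, A ≠ B ∧ (I.sep A ∩ I.sep B).Nonempty ∧
    v ∈ rep P s(A, B)

/-- The cost of an autarkic collection: the total length of the connectors of its tuples. The
connector of a tuple is a minimum Steiner tree on the endpoints of its designated representatives;
for a pair this is a shortest path between the two endpoints. -/
def connectorCost (rep : Finset (Finset V) → Sym2 (Finset V) → Sym2 V)
    (𝒬 : Finset (Finset (Finset V))) : ℝ :=
  ∑ P ∈ 𝒬, I.steinerCost (I.connectorTerminals rep P)

end

end SteinerForestInstance

set_option linter.unusedSectionVars false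

namespace SteinerForestInstance

noncomputable section

open scoped Classical

variable {V : Type*} [Fintype V]

section

/-! ### Linked vertices, components and cuts -/

/-! Fix an optimal solution `F`. For a component `T` of `(V, F)`, a vertex is late if its moat
component stays active until all of `T` lies in one moat component. The collection `𝒮` consists of
the sets of late vertices, one for each `T`. A clean pair of `T` consists of two demand-active sets,
each crossed by a single edge of `F`, that are the only active sets meeting the late vertices of `T`
at some moment. The autarkic collection takes one clean pair from every `T` that ever has one;
triples are never used.

Every quantity is written as a sum over phases of duration times a rate (`sepValue_eq`, `gain_eq`,
`coverage_eq`, `excess_eq`, `sum_totalCost_le`). Connector costs and excess also contain slack, the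
part of edge costs not paid by `y`. It then remains to compare rates.

Demand-active sets are of two kinds (`card_demandActive_le`). A premature set contains no late
vertex of an unfinished `T`. Its growth earns budget, which must be spent before its vertices become
inactive. Meanwhile the solution still has to leave the spending component, and by optimality it
does so with at least two edges. All these edges count as excess, which gives the term `1 / (2 * ε)`
(`premature_invariant`, `premature_le`).

Let `L` be the number of active sets with late vertices of unfinished components, and `p` the number
of unfinished components having late vertices. Merging along `𝒮` gives gain at rate at least `2 * (L
- p)` (`mergedCount_late_le`). `ConnectorData.phase_inequality` bounds `20 * p` plus weighted
connector crossings by `17 * L` plus coverage and surplus. Divided by 3, this leaves exactly one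
copy of `L`, as `20 / 3 - 17 / 3 = 1`. Its proof adds an inequality for each active set
(`set_inequality`) to one for each component (`component_inequality_paired`,
`component_inequality_unpaired`). The second kind rests on the fact that clean sets of `T` in
different phases separate the same demand pairs when they contain the same late vertices
(`CleanPair.le_card_covered`). -/

theorem Linked.refl (F : Finset (Sym2 V)) (v : V) : Linked F v v := SimpleGraph.Reachable.refl v

theorem Linked.symm {F : Finset (Sym2 V)} {u v : V} (h : Linked F u v) : Linked F v u :=
  SimpleGraph.Reachable.symm h

theorem Linked.trans {F : Finset (Sym2 V)} {u v w : V} (h : Linked F u v) (h' : Linked F v w) :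
    Linked F u w := SimpleGraph.Reachable.trans h h'

theorem Linked.of_mem {F : Finset (Sym2 V)} {u v : V} (h : s(u, v) ∈ F) : Linked F u v := by
  by_cases huv : u = v
  · subst huv; exact Linked.refl F u
  · exact SimpleGraph.Adj.reachable (by simp [SimpleGraph.fromEdgeSet_adj, h, huv])

theorem Linked.induction {F : Finset (Sym2 V)} {u v : V} (h : Linked F u v) {p : V → Prop}
    (h0 : p u) (h1 : ∀ x y, s(x, y) ∈ F → p x → p y) : p v := by
  obtain ⟨w⟩ := h
  induction w with
  | nil => exact h0
  | cons hadj _ ih =>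
    refine ih (h1 _ _ ?_ h0)
    simpa using (SimpleGraph.fromEdgeSet_adj _ |>.1 hadj).1

theorem Linked.mono {F F' : Finset (Sym2 V)} (hF : F ⊆ F') {u v : V} (h : Linked F u v) :
    Linked F' u v :=
  h.induction (Linked.refl F' u) fun _ _ hxy hx => hx.trans (Linked.of_mem (hF hxy))

/-- The component of `v` in the graph `(V, F)`. -/
def component (F : Finset (Sym2 V)) (v : V) : Finset V := Finset.univ.filter fun u => Linked F v u

@[simp] theorem mem_component {F : Finset (Sym2 V)} {u v : V} :
    u ∈ component F v ↔ Linked F v u := by simp [component]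

theorem self_mem_component (F : Finset (Sym2 V)) (v : V) : v ∈ component F v := by
  simp [Linked.refl]

theorem component_mem_components (F : Finset (Sym2 V)) (v : V) : component F v ∈ components F :=
  Finset.mem_image_of_mem _ (Finset.mem_univ v)

theorem component_eq_of_linked {F : Finset (Sym2 V)} {u v : V} (h : Linked F u v) :
    component F u = component F v := by
  ext w
  simp only [mem_component]
  exact ⟨h.symm.trans, h.trans⟩

theorem eq_component_of_mem {F : Finset (Sym2 V)} {S : Finset V} (hS : S ∈ components F) {v : V}
    (hv : v ∈ S) : S = component F v := by
  obtain ⟨w, -, rfl⟩ := Finset.mem_image.1 hS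
  exact component_eq_of_linked (by simpa using hv)

theorem nonempty_of_mem_components {F : Finset (Sym2 V)} {S : Finset V} (hS : S ∈ components F) :
    S.Nonempty := by
  obtain ⟨w, -, rfl⟩ := Finset.mem_image.1 hS
  exact ⟨w, self_mem_component F w⟩

theorem mem_components_iff {F : Finset (Sym2 V)} {S : Finset V} :
    S ∈ components F ↔ ∃ v, S = component F v :=
  ⟨fun h => (nonempty_of_mem_components h).imp fun _ => eq_component_of_mem h,
    fun ⟨v, hv⟩ => hv ▸ component_mem_components F v⟩

theorem mem_iff_mem_of_linked {F : Finset (Sym2 V)} {S : Finset V} (hS : S ∈ components F)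
    {u v : V} (h : Linked F u v) : u ∈ S ↔ v ∈ S := by
  obtain ⟨w, rfl⟩ := mem_components_iff.1 hS
  simp only [mem_component]
  exact ⟨fun hu => hu.trans h, fun hv => hv.trans h.symm⟩

theorem linked_of_mem_components {F : Finset (Sym2 V)} {S : Finset V} (hS : S ∈ components F)
    {u v : V} (hu : u ∈ S) (hv : v ∈ S) : Linked F u v := by
  rw [eq_component_of_mem hS hu] at hv
  simpa using hv

theorem eq_of_mem_components {F : Finset (Sym2 V)} {S S' : Finset V} (hS : S ∈ components F)
    (hS' : S' ∈ components F) {v : V} (hv : v ∈ S) (hv' : v ∈ S') : S = S' :=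
  (eq_component_of_mem hS hv).trans (eq_component_of_mem hS' hv').symm

theorem disjoint_of_mem_components {F : Finset (Sym2 V)} {S S' : Finset V}
    (hS : S ∈ components F) (hS' : S' ∈ components F) (hne : S ≠ S') : Disjoint S S' :=
  Finset.disjoint_left.2 fun _ hv hv' => hne (eq_of_mem_components hS hS' hv hv')

theorem component_mono {F F' : Finset (Sym2 V)} (hF : F ⊆ F') (v : V) :
    component F v ⊆ component F' v := fun u => by
  simpa using Linked.mono hF

theorem separates_mk {U : Finset V} {a b : V} :
    Separates U s(a, b) ↔ (a ∈ U ∧ b ∉ U) ∨ (a ∉ U ∧ b ∈ U) := by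
  simp only [Separates, Sym2.mem_iff, exists_eq_or_imp, exists_eq_left]
  tauto

theorem not_separates_of_mem_components {F : Finset (Sym2 V)} {S : Finset V}
    (hS : S ∈ components F) {e : Sym2 V} (he : e ∈ F) : ¬ Separates S e := by
  induction e with
  | _ a b =>
    rw [separates_mk]
    have := mem_iff_mem_of_linked hS (Linked.of_mem he)
    tauto

theorem Linked.exists_separates {F : Finset (Sym2 V)} {u v : V} (h : Linked F u v) {U : Finset V}
    (hu : u ∈ U) (hv : v ∉ U) : ∃ e ∈ F, Separates U e := by
  by_contra! hcon
  refine hv (h.induction (p := fun w => w ∈ U) hu fun x y hxy hx => ?_)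
  by_contra hy
  exact hcon _ hxy (separates_mk.2 (Or.inl ⟨hx, hy⟩))

/-- An edge that is alone in a cut is not needed to link two vertices on the same side. -/
theorem Linked.erase {F : Finset (Sym2 V)} {U : Finset V} {e : Sym2 V}
    (he : F.filter (Separates U) = {e}) {u v : V} (huv : u ∈ U ↔ v ∈ U) (h : Linked F u v) :
    Linked (F.erase e) u v := by
  have heF : e ∈ F ∧ Separates U e := by
    rw [← Finset.mem_filter, he]; simp
  have key : ∀ x y, s(x, y) ∈ F → Separates U s(x, y) → s(x, y) = e := fun x y h1 h2 => by
    have : s(x, y) ∈ F.filter (Separates U) := Finset.mem_filter.2 ⟨h1, h2⟩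
    simpa [he] using this
  obtain ⟨x, y, rfl, hx, hy⟩ : ∃ x y, e = s(x, y) ∧ x ∈ U ∧ y ∉ U := by
    obtain ⟨-, hs⟩ := heF
    induction e with
    | _ a b =>
      rcases separates_mk.1 hs with h | h
      · exact ⟨a, b, rfl, h⟩
      · exact ⟨b, a, Sym2.eq_swap, h.2, h.1⟩
  -- On the side of `u`, the walk is linked to `u` without `e`. On the other side it is enough to
  -- remember that `u` is linked to the end of `e` on its own side: the walk can return only through
  -- `e`, hence to that same end.
  have := h.induction
    (p := fun w => if (u ∈ U ↔ w ∈ U) then Linked (F.erase s(x, y)) u w else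
      if u ∈ U then Linked (F.erase s(x, y)) u x else Linked (F.erase s(x, y)) u y)
    (by simp [Linked.refl]) (fun w w' hww hw => by
      by_cases heq : s(w, w') = s(x, y)
      · rcases Sym2.eq_iff.1 heq with ⟨rfl, rfl⟩ | ⟨rfl, rfl⟩
        · by_cases hu : u ∈ U <;> simp_all
        · by_cases hu : u ∈ U <;> simp_all
      · have hl : Linked (F.erase s(x, y)) w w' :=
          Linked.of_mem (Finset.mem_erase.2 ⟨heq, hww⟩)
        have hns : ¬ Separates U s(w, w') := fun hs => heq (key _ _ hww hs)
        have hiff : w ∈ U ↔ w' ∈ U := by rw [separates_mk] at hns; tauto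
        simp only [← hiff]
        split_ifs at hw ⊢
        · exact hw.trans hl
        · exact hw
        · exact hw)
  simpa [huv] using this

/-- A minimal set of edges linking the vertices of `S`: a cut that contains only one of its edges
splits `S`. -/
theorem exists_minimal_connector (F₀ : Finset (Sym2 V)) (S : Finset V)
    (h : ∀ u ∈ S, ∀ v ∈ S, Linked F₀ u v) :
    ∃ F ⊆ F₀, (∀ u ∈ S, ∀ v ∈ S, Linked F u v) ∧
      ∀ U, (F.filter (Separates U)).card = 1 → (∃ u ∈ S, u ∈ U) ∧ ∃ v ∈ S, v ∉ U := by
  obtain ⟨F, hF, hmin⟩ := Finset.exists_min_image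
    (F₀.powerset.filter fun F => ∀ u ∈ S, ∀ v ∈ S, Linked F u v) Finset.card
    ⟨F₀, by simpa using h⟩
  simp only [Finset.mem_filter, Finset.mem_powerset] at hF hmin
  refine ⟨F, hF.1, hF.2, fun U hU => ?_⟩
  obtain ⟨e, he⟩ := Finset.card_eq_one.1 hU
  have heF : e ∈ F := (Finset.mem_filter.1 (he ▸ Finset.mem_singleton_self e)).1
  by_contra hcon
  have hside : ∀ u ∈ S, ∀ v ∈ S, (u ∈ U ↔ v ∈ U) := by
    intro u hu v hv
    by_contra hne
    refine hcon ?_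
    by_cases huU : u ∈ U
    · exact ⟨⟨u, hu, huU⟩, v, hv, by tauto⟩
    · exact ⟨⟨v, hv, by tauto⟩, u, hu, huU⟩
  have := hmin (F.erase e) ⟨(Finset.erase_subset e F).trans hF.1,
    fun u hu v hv => (hF.2 u hu v hv).erase he (hside u hu v hv)⟩
  have := Finset.card_erase_lt_of_mem heF
  omega

/-- The edges of `F` inside `T`. -/
def inner (F : Finset (Sym2 V)) (T : Finset V) : Finset (Sym2 V) :=
  F.filter fun e => ∀ v ∈ e, v ∈ T

theorem linked_inner {F : Finset (Sym2 V)} {T : Finset V} (hT : T ∈ components F) {u v : V}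
    (hu : u ∈ T) (h : Linked F u v) : Linked (inner F T) u v := by
  refine (h.induction (p := fun w => w ∈ T ∧ Linked (inner F T) u w) ⟨hu, Linked.refl _ u⟩
    fun x y hxy hx => ?_).2
  have hy : y ∈ T := (mem_iff_mem_of_linked hT (Linked.of_mem hxy)).1 hx.1
  refine ⟨hy, hx.2.trans (Linked.of_mem ?_)⟩
  simp [inner, hxy, hx.1, hy]

/-- Disjointness of the edge sets of different components. -/
theorem sum_inner_le (F : Finset (Sym2 V)) (𝒯 : Finset (Finset V)) (h𝒯 : 𝒯 ⊆ components F)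
    (G : Finset V → Finset (Sym2 V)) (hG : ∀ T ∈ 𝒯, G T ⊆ inner F T) (f : Sym2 V → ℝ)
    (hf : ∀ e ∈ F, 0 ≤ f e) : ∑ T ∈ 𝒯, ∑ e ∈ G T, f e ≤ ∑ e ∈ F, f e := by
  rw [← Finset.sum_biUnion]
  · refine Finset.sum_le_sum_of_subset_of_nonneg ?_ fun e he _ => hf e he
    exact Finset.biUnion_subset.2 fun T hT => (hG T hT).trans (Finset.filter_subset _ _)
  · intro T hT T' hT' hne
    refine Finset.disjoint_left.2 fun e he he' => hne ?_
    have h1 := (Finset.mem_filter.1 (hG T hT he)).2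
    have h2 := (Finset.mem_filter.1 (hG T' hT' he')).2
    induction e with
    | _ a b => exact eq_of_mem_components (h𝒯 hT) (h𝒯 hT') (h1 a (by simp)) (h2 a (by simp))

theorem sum_card_inner_le (F : Finset (Sym2 V)) (𝒯 : Finset (Finset V)) (h𝒯 : 𝒯 ⊆ components F)
    (G : Finset V → Finset (Sym2 V)) (hG : ∀ T ∈ 𝒯, G T ⊆ inner F T) (U : Finset V) :
    ∑ T ∈ 𝒯, ((G T).filter (Separates U)).card ≤ (F.filter (Separates U)).card := by
  have := sum_inner_le F 𝒯 h𝒯 G hG (fun e => if Separates U e then 1 else 0)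
    (fun e _ => by positivity)
  simp only [← Finset.sum_filter, Finset.sum_const, nsmul_eq_mul, mul_one] at this
  exact_mod_cast this

/-- Adding edges merges components. -/
theorem card_components_lt {F F' : Finset (Sym2 V)} (hF : F ⊆ F') {S : Finset V}
    (hS : S ∈ components F) {e : Sym2 V} (he : e ∈ F') (hSe : Separates S e) :
    (components F').card < (components F).card := by
  have himg : components F' = (components F).image
      fun S => Finset.univ.filter fun u => ∃ s ∈ S, Linked F' s u := by
    ext C
    simp only [Finset.mem_image]
    constructor
    · intro hC
      obtain ⟨v, rfl⟩ := mem_components_iff.1 hC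
      refine ⟨component F v, component_mem_components F v, ?_⟩
      ext u
      simp only [Finset.mem_filter, Finset.mem_univ, true_and, mem_component]
      exact ⟨fun ⟨s, hs, hsu⟩ => (hs.mono hF).trans hsu, fun h => ⟨v, Linked.refl F v, h⟩⟩
    · rintro ⟨A, hA, rfl⟩
      obtain ⟨v, rfl⟩ := mem_components_iff.1 hA
      refine mem_components_iff.2 ⟨v, ?_⟩
      ext u
      simp only [Finset.mem_filter, Finset.mem_univ, true_and, mem_component]
      exact ⟨fun ⟨s, hs, hsu⟩ => (hs.mono hF).trans hsu, fun h => ⟨v, Linked.refl F v, h⟩⟩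
  rw [himg]
  -- Equal cardinalities would make the merging map injective, but the new edge sends two different
  -- components to the same one.
  refine lt_of_le_of_ne Finset.card_image_le fun hcard => ?_
  have hinj := Finset.card_image_iff.1 hcard
  obtain ⟨a, b, rfl, ha, hb⟩ : ∃ a b, e = s(a, b) ∧ a ∈ S ∧ b ∉ S := by
    induction e with
    | _ a b =>
      rcases separates_mk.1 hSe with h | h
      · exact ⟨a, b, rfl, h⟩
      · exact ⟨b, a, Sym2.eq_swap, h.2, h.1⟩
  have hab : Linked F' a b := Linked.of_mem he
  have := hinj (component_mem_components F a) (component_mem_components F b) (by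
    ext u
    simp only [Finset.mem_filter, Finset.mem_univ, true_and, mem_component]
    exact ⟨fun ⟨s, hs, hsu⟩ => ⟨b, Linked.refl F b, hab.symm.trans ((hs.mono hF).trans hsu)⟩,
      fun ⟨s, hs, hsu⟩ => ⟨a, Linked.refl F a, hab.trans ((hs.mono hF).trans hsu)⟩⟩)
  rw [eq_component_of_mem hS ha, this] at hb
  exact hb (self_mem_component F b)

theorem components_eq_of_not_separates {F F' : Finset (Sym2 V)} (hF : F ⊆ F')
    (h : ∀ S ∈ components F, ∀ e ∈ F', ¬ Separates S e) (u v : V) :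
    Linked F' u v ↔ Linked F u v := by
  refine ⟨fun huv => ?_, Linked.mono hF⟩
  refine huv.induction (p := fun w => Linked F u w) (Linked.refl F u) fun x y hxy hx => ?_
  have := h _ (component_mem_components F u) _ hxy
  rw [separates_mk] at this
  simp only [mem_component] at this
  tauto

theorem card_components_le (F : Finset (Sym2 V)) : (components F).card ≤ Fintype.card V :=
  Finset.card_image_le

end

section

variable (I : SteinerForestInstance V)

/-! ### One step of the moat-growing algorithm -/

/-- The invariants of the algorithm: the dual constraints hold and budgets are nonnegative. -/
structure Valid (σ : State V) : Prop where
  load_le : ∀ e ∈ I.edges, I.load σ.y e ≤ I.cost e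
  budget_nonneg : ∀ S ∈ I.comps σ, 0 ≤ σ.budget S

variable {I}

theorem mem_cut {U : Finset V} {e : Sym2 V} : e ∈ I.cut U ↔ e ∈ I.edges ∧ Separates U e := by
  simp [cut]

theorem demandActive_subset (σ : State V) : I.demandActive σ ⊆ I.comps σ :=
  Finset.filter_subset _ _

theorem budgetActive_subset (σ : State V) : I.budgetActive σ ⊆ I.comps σ :=
  Finset.filter_subset _ _

theorem active_subset (σ : State V) : I.active σ ⊆ I.comps σ :=
  Finset.union_subset (demandActive_subset σ) (budgetActive_subset σ)

theorem disjoint_demandActive_budgetActive (σ : State V) :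
    Disjoint (I.demandActive σ) (I.budgetActive σ) :=
  Finset.disjoint_left.2 fun _ h h' => (Finset.mem_filter.1 h').2.1 h

theorem valid_initial : I.Valid initial where
  load_le e he := by
    have := I.cost_nonneg e (by simpa [edges] using he)
    simpa [load, initial] using this
  budget_nonneg S _ := by simp [initial]

theorem waits_pos {σ : State V} (hσ : I.Valid σ) {w : ℝ} (hw : w ∈ I.waits σ) : 0 < w := by
  rcases Finset.mem_union.1 hw with h | h
  · obtain ⟨e, he, rfl⟩ := Finset.mem_image.1 h
    obtain ⟨he, hnt, hr⟩ := Finset.mem_filter.1 he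
    have h1 := hσ.load_le e he
    have h2 : I.load σ.y e ≠ I.cost e := fun h => hnt (Finset.mem_filter.2 ⟨he, h⟩)
    have h3 := lt_of_le_of_ne h1 h2
    have : (0 : ℝ) < I.rate σ e := by exact_mod_cast hr
    exact div_pos (by linarith) this
  · obtain ⟨S, hS, rfl⟩ := Finset.mem_image.1 h
    exact (Finset.mem_filter.1 hS).2.2

theorem load_grow (ε : ℝ) (σ : State V) (Δ : ℝ) (e : Sym2 V) :
    I.load (I.grow ε σ Δ).y e = I.load σ.y e + I.rate σ e * Δ := by
  simp only [load, grow, Finset.sum_add_distrib, rate]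
  congr 1
  rw [← Finset.sum_filter, Finset.sum_const, nsmul_eq_mul]
  congr 3
  ext S
  simp [and_comm]

theorem rate_eq_zero_of_tight {σ : State V} {e : Sym2 V} (he : e ∈ I.tightEdges σ) :
    I.rate σ e = 0 := by
  refine Finset.card_eq_zero.2 (Finset.filter_eq_empty_iff.2 fun S hS hcut => ?_)
  exact not_separates_of_mem_components (active_subset σ hS) he (mem_cut.1 hcut).2

theorem tightEdges_subset_grow (ε : ℝ) (σ : State V) (Δ : ℝ) :
    I.tightEdges σ ⊆ I.tightEdges (I.grow ε σ Δ) := by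
  intro e he
  have h0 := rate_eq_zero_of_tight he
  obtain ⟨h1, h2⟩ := Finset.mem_filter.1 he
  refine Finset.mem_filter.2 ⟨h1, ?_⟩
  rw [load_grow, h0, h2]; simp

theorem grownBudget_nonneg {ε : ℝ} (hε : 0 < ε) {σ : State V} (hσ : I.Valid σ) {Δ : ℝ}
    (hΔ : 0 ≤ Δ) (hΔ' : ∀ w ∈ I.waits σ, Δ ≤ w) {S : Finset V} (hS : S ∈ I.comps σ) :
    0 ≤ I.grownBudget ε σ Δ S := by
  have h0 := hσ.budget_nonneg S hS
  unfold grownBudget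
  split_ifs with h1 h2
  · positivity
  · have := hΔ' (σ.budget S) (Finset.mem_union_right _ (Finset.mem_image_of_mem _ h2))
    linarith
  · linarith

theorem Valid.grow {ε : ℝ} (hε : 0 < ε) {σ : State V} (hσ : I.Valid σ) {Δ : ℝ}
    (hΔ : 0 ≤ Δ) (hΔ' : ∀ w ∈ I.waits σ, Δ ≤ w) : I.Valid (I.grow ε σ Δ) where
  load_le e he := by
    rw [load_grow]
    by_cases ht : e ∈ I.tightEdges σ
    · rw [rate_eq_zero_of_tight ht]; simpa using hσ.load_le e he
    by_cases hr : 0 < I.rate σ e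
    · have := hΔ' _ (Finset.mem_union_left _ (Finset.mem_image_of_mem _
        (Finset.mem_filter.2 ⟨he, ht, hr⟩)))
      have hr' : (0 : ℝ) < I.rate σ e := by exact_mod_cast hr
      rw [le_div_iff₀ hr'] at this
      linarith
    · have : I.rate σ e = 0 := by omega
      rw [this]; simpa using hσ.load_le e he
  budget_nonneg S _ := Finset.sum_nonneg fun S' hS' =>
    grownBudget_nonneg hε hσ hΔ hΔ' (Finset.mem_filter.1 hS').1

theorem step_of_nonempty (ε : ℝ) {σ : State V} (h : (I.waits σ).Nonempty) :
    I.step ε σ = I.grow ε σ ((I.waits σ).min' h) := by simp [step, h]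

theorem step_of_empty (ε : ℝ) {σ : State V} (h : I.waits σ = ∅) : I.step ε σ = σ := by
  simp [step, h]

theorem Valid.step {ε : ℝ} (hε : 0 < ε) {σ : State V} (hσ : I.Valid σ) : I.Valid (I.step ε σ) := by
  by_cases h : (I.waits σ).Nonempty
  · rw [step_of_nonempty ε h]
    exact hσ.grow hε (waits_pos hσ (Finset.min'_mem _ h)).le fun w hw => Finset.min'_le _ w hw
  · rwa [step_of_empty ε (Finset.not_nonempty_iff_eq_empty.1 h)]

theorem tightEdges_subset_step (ε : ℝ) (σ : State V) :
    I.tightEdges σ ⊆ I.tightEdges (I.step ε σ) := by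
  by_cases h : (I.waits σ).Nonempty
  · rw [step_of_nonempty ε h]
    exact tightEdges_subset_grow ε σ _
  · rw [step_of_empty ε (Finset.not_nonempty_iff_eq_empty.1 h)]

theorem card_budgetActive_le (σ : State V) : (I.budgetActive σ).card ≤ Fintype.card V :=
  (Finset.card_le_card (budgetActive_subset σ)).trans (card_components_le _)

/-- Every event merges components or lets the budget of a component run out. -/
theorem step_decreases {ε : ℝ} {σ : State V} (hσ : I.Valid σ) (h : (I.waits σ).Nonempty) :
    (I.comps (I.step ε σ)).card * (Fintype.card V + 1) + (I.budgetActive (I.step ε σ)).card <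
      (I.comps σ).card * (Fintype.card V + 1) + (I.budgetActive σ).card := by
  have hsub := tightEdges_subset_step (I := I) ε σ
  by_cases hnew : ∃ S ∈ I.comps σ, ∃ e ∈ I.tightEdges (I.step ε σ), Separates S e
  · obtain ⟨S, hS, e, he, hSe⟩ := hnew
    have h1 : (I.comps (I.step ε σ)).card < (I.comps σ).card :=
      card_components_lt hsub hS he hSe
    have h2 := card_budgetActive_le (I := I) (I.step ε σ)
    nlinarith
  · push Not at hnew
    have hlink := components_eq_of_not_separates hsub hnew
    have hcomps : I.comps (I.step ε σ) = I.comps σ := by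
      simp only [comps, components, hlink]
    have hdem : I.demandActive (I.step ε σ) = I.demandActive σ := by
      simp only [demandActive, hcomps, hlink]
    rw [hcomps]
    refine Nat.add_lt_add_left (Finset.card_lt_card ?_) _
    set Δ := (I.waits σ).min' h with hΔ
    have hΔpos : 0 < Δ := waits_pos hσ (Finset.min'_mem _ h)
    have hbud : ∀ S ∈ I.comps σ, (I.step ε σ).budget S = I.grownBudget ε σ Δ S := by
      intro S hS
      rw [step_of_nonempty ε h]
      change ∑ S' ∈ (I.comps σ).filter (fun S' => S' ⊆ S), _ = _
      have : (I.comps σ).filter (fun S' => S' ⊆ S) = {S} := by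
        ext S'
        simp only [Finset.mem_filter, Finset.mem_singleton]
        constructor
        · rintro ⟨h1, h2⟩
          obtain ⟨v, hv⟩ := nonempty_of_mem_components h1
          exact eq_of_mem_components h1 hS hv (h2 hv)
        · rintro rfl; exact ⟨hS, subset_rfl⟩
      rw [this, Finset.sum_singleton]
    obtain ⟨B, hB, hBΔ⟩ : ∃ B ∈ I.budgetActive σ, σ.budget B = Δ := by
      rcases Finset.mem_union.1 (Finset.min'_mem _ h) with hm | hm
      · exfalso
        obtain ⟨e, he, heq⟩ := Finset.mem_image.1 hm
        obtain ⟨he, hnt, hr⟩ := Finset.mem_filter.1 he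
        obtain ⟨S, hS⟩ := Finset.card_pos.1 hr
        obtain ⟨hS, hcut⟩ := Finset.mem_filter.1 hS
        refine hnew S (active_subset σ hS) e (Finset.mem_filter.2 ⟨he, ?_⟩) (mem_cut.1 hcut).2
        have hr' : (I.rate σ e : ℝ) ≠ 0 := by exact_mod_cast hr.ne'
        rw [step_of_nonempty ε h, load_grow, ← heq]
        field_simp
        ring
      · obtain ⟨B, hB, h2⟩ := Finset.mem_image.1 hm
        exact ⟨B, hB, h2⟩
    have hBnd := (Finset.mem_filter.1 hB).2.1
    refine (Finset.ssubset_iff_of_subset ?_).2 ⟨B, hB, fun hB' => ?_⟩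
    · intro S hS
      obtain ⟨h1, h2, h3⟩ := Finset.mem_filter.1 hS
      rw [hcomps] at h1
      rw [hdem] at h2
      rw [hbud S h1, grownBudget, if_neg h2] at h3
      refine Finset.mem_filter.2 ⟨h1, h2, ?_⟩
      split_ifs at h3 <;> linarith
    · have h3 := (Finset.mem_filter.1 hB').2.2
      rw [hbud B (budgetActive_subset σ hB), grownBudget, if_neg hBnd, if_pos hB, hBΔ] at h3
      linarith

/-- A solution leaves every demand-active component. The leaving edge cannot be tight and its load
grows, so a further event would be due. A budget-active component is itself waiting for its budget
to run out. -/
theorem active_eq_empty_of_waits {F : Finset (Sym2 V)} (hF : I.IsSolution F) {σ : State V}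
    (h : I.waits σ = ∅) : I.active σ = ∅ := by
  have hbud : I.budgetActive σ = ∅ := by
    have := (Finset.union_eq_empty.1 h).2
    simpa using this
  have hdem : I.demandActive σ = ∅ := by
    refine Finset.eq_empty_of_forall_notMem fun S hS => ?_
    obtain ⟨hSc, a, ha, b, hab, hl⟩ := Finset.mem_filter.1 hS
    have hb : b ∉ S := fun hb => hl (linked_of_mem_components hSc ha hb)
    obtain ⟨e, he, hSe⟩ := (hF.2 a b hab).exists_separates ha hb
    have hnt : e ∉ I.tightEdges σ := fun ht => not_separates_of_mem_components hSc ht hSe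
    have hr : 0 < I.rate σ e := Finset.card_pos.2 ⟨S, Finset.mem_filter.2
      ⟨Finset.mem_union_left _ hS, mem_cut.2 ⟨hF.1 he, hSe⟩⟩⟩
    have := (Finset.union_eq_empty.1 h).1
    rw [Finset.image_eq_empty, Finset.filter_eq_empty_iff] at this
    exact this (hF.1 he) ⟨hnt, hr⟩
  rw [active, hbud, hdem, Finset.union_empty]

/-! ### The run of the algorithm -/

variable (I) (ε : ℝ)

theorem state_succ (k : ℕ) : I.state ε (k + 1) = I.step ε (I.state ε k) :=
  Function.iterate_succ_apply' _ _ _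

/-- The duration of the phase that starts with the `k`-th event. -/
def duration (k : ℕ) : ℝ := (I.state ε (k + 1)).time - (I.state ε k).time

/-- The component of `v` after the `k`-th event. -/
def comp (k : ℕ) (v : V) : Finset V := component (I.tightEdges (I.state ε k)) v

variable {ε}

theorem valid_state (hε : 0 < ε) (k : ℕ) : I.Valid (I.state ε k) := by
  induction k with
  | zero => exact valid_initial
  | succ k ih => rw [state_succ]; exact ih.step hε

variable (ε)

theorem tightEdges_mono {j k : ℕ} (h : j ≤ k) :
    I.tightEdges (I.state ε j) ⊆ I.tightEdges (I.state ε k) := by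
  induction k, h using Nat.le_induction with
  | base => exact subset_rfl
  | succ k _ ih => rw [state_succ]; exact ih.trans (tightEdges_subset_step ε _)

variable {ε}

theorem exists_waits_empty (hε : 0 < ε) : ∃ k, I.waits (I.state ε k) = ∅ := by
  by_contra! hcon
  -- A lexicographic potential: there are at most `Fintype.card V` budget-active components, so
  -- losing one component outweighs any change in their number.
  let μ : ℕ → ℕ := fun k => (I.comps (I.state ε k)).card * (Fintype.card V + 1) +
    (I.budgetActive (I.state ε k)).card
  have hμ : ∀ k, μ (k + 1) < μ k := fun k => by
    simp only [μ, state_succ]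
    exact step_decreases (I.valid_state hε k) (hcon k)
  have : ∀ k, μ k + k ≤ μ 0 := by
    intro k
    induction k with
    | zero => simp
    | succ k ih => have := hμ k; omega
  have := this (μ 0 + 1)
  omega

variable (ε)

/-- The number of phases: the index of the final event. -/
def horizon : ℕ := sInf {k | I.waits (I.state ε k) = ∅}

variable {ε}

theorem waits_horizon (hε : 0 < ε) : I.waits (I.state ε (I.horizon ε)) = ∅ :=
  Nat.sInf_mem (s := {k | I.waits (I.state ε k) = ∅}) (I.exists_waits_empty hε)

theorem waits_nonempty_of_lt {k : ℕ} (hk : k < I.horizon ε) : (I.waits (I.state ε k)).Nonempty :=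
  Finset.nonempty_iff_ne_empty.2 fun h => Nat.notMem_of_lt_sInf hk h

theorem state_eq_horizon (hε : 0 < ε) {k : ℕ} (hk : I.horizon ε ≤ k) :
    I.state ε k = I.state ε (I.horizon ε) := by
  induction k, hk using Nat.le_induction with
  | base => rfl
  | succ k _ ih => rw [state_succ, ih, step_of_empty ε (I.waits_horizon hε)]

theorem active_eq_empty (hε : 0 < ε) {F : Finset (Sym2 V)} (hF : I.IsSolution F) {k : ℕ}
    (hk : I.horizon ε ≤ k) : I.active (I.state ε k) = ∅ := by
  rw [I.state_eq_horizon hε hk]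
  exact active_eq_empty_of_waits hF (I.waits_horizon hε)

theorem lt_horizon_of_mem_active (hε : 0 < ε) {F : Finset (Sym2 V)} (hF : I.IsSolution F) {k : ℕ}
    {S : Finset V} (hS : S ∈ I.active (I.state ε k)) : k < I.horizon ε := by
  by_contra! h
  simp [I.active_eq_empty hε hF h] at hS

theorem state_succ_eq_grow {k : ℕ} (hk : k < I.horizon ε) :
    I.state ε (k + 1) = I.grow ε (I.state ε k) (I.duration ε k) := by
  have h := I.waits_nonempty_of_lt hk
  have h1 : I.state ε (k + 1) = I.grow ε (I.state ε k) ((I.waits (I.state ε k)).min' h) := by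
    rw [state_succ, step_of_nonempty ε h]
  have h2 : I.duration ε k = (I.waits (I.state ε k)).min' h := by
    rw [duration, h1]; simp [grow]
  rw [h2, h1]

theorem duration_mem_waits {k : ℕ} (hk : k < I.horizon ε) :
    I.duration ε k ∈ I.waits (I.state ε k) ∧ ∀ w ∈ I.waits (I.state ε k), I.duration ε k ≤ w := by
  have h := I.waits_nonempty_of_lt hk
  have h2 : I.duration ε k = (I.waits (I.state ε k)).min' h := by
    rw [duration, state_succ, step_of_nonempty ε h]; simp [grow]
  rw [h2]
  exact ⟨Finset.min'_mem _ h, fun w hw => Finset.min'_le _ w hw⟩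

theorem duration_pos (hε : 0 < ε) {k : ℕ} (hk : k < I.horizon ε) : 0 < I.duration ε k :=
  waits_pos (I.valid_state hε k) (I.duration_mem_waits hk).1

theorem time_lt (hε : 0 < ε) {j k : ℕ} (hjk : j < k) (hk : k ≤ I.horizon ε) :
    (I.state ε j).time < (I.state ε k).time := by
  induction k, hjk using Nat.le_induction with
  | base => have := I.duration_pos hε (k := j) (by omega); rw [duration] at this; simpa using this
  | succ k hk' ih =>
    have := I.duration_pos hε (k := k) (by omega)
    rw [duration] at this
    have := ih (by omega)
    linarith

theorem time_le (hε : 0 < ε) {j k : ℕ} (hjk : j ≤ k) (hk : k ≤ I.horizon ε) :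
    (I.state ε j).time ≤ (I.state ε k).time := by
  rcases hjk.eq_or_lt with rfl | h
  · rfl
  · exact (I.time_lt hε h hk).le

theorem time_nonneg (hε : 0 < ε) {k : ℕ} (hk : k ≤ I.horizon ε) : 0 ≤ (I.state ε k).time := by
  have := I.time_le hε (Nat.zero_le k) hk
  simpa [state, initial] using this

theorem y_horizon (k : ℕ) (hk : k ≤ I.horizon ε) (S : Finset V) : (I.state ε k).y S =
    ∑ j ∈ Finset.range k, if S ∈ I.active (I.state ε j) then I.duration ε j else 0 := by
  induction k with
  | zero => simp [state, initial]
  | succ k ih =>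
    rw [Finset.sum_range_succ, ← ih (by omega), I.state_succ_eq_grow (by omega)]
    rfl

/-- The dual variables never decrease and are frozen from the horizon on, so the supremum is
attained there. -/
theorem dual_eq_sum (hε : 0 < ε) (S : Finset V) : I.dual ε S =
    ∑ j ∈ Finset.range (I.horizon ε),
      if S ∈ I.active (I.state ε j) then I.duration ε j else 0 := by
  rw [← I.y_horizon _ le_rfl]
  have hle : ∀ k, (I.state ε k).y S ≤ (I.state ε (I.horizon ε)).y S := by
    intro k
    by_cases hk : k ≤ I.horizon ε
    · rw [I.y_horizon k hk, I.y_horizon _ le_rfl]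
      refine Finset.sum_le_sum_of_subset_of_nonneg (Finset.range_subset_range.2 hk)
        fun j hj _ => ?_
      have := (I.duration_pos hε (Finset.mem_range.1 hj)).le
      split_ifs <;> simp [this]
    · rw [I.state_eq_horizon hε (by omega)]
  exact le_antisymm (ciSup_le hle) (le_ciSup (f := fun k => (I.state ε k).y S)
    ⟨_, by rintro _ ⟨k, rfl⟩; exact hle k⟩ (I.horizon ε))

theorem dual_nonneg (hε : 0 < ε) (S : Finset V) : 0 ≤ I.dual ε S := by
  rw [I.dual_eq_sum hε]
  refine Finset.sum_nonneg fun j hj => ?_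
  have := (I.duration_pos hε (Finset.mem_range.1 hj)).le
  split_ifs <;> simp [this]

/-- Sums of dual variables as sums over phases. -/
theorem sum_dual (hε : 0 < ε) (f : Finset V → ℝ) : ∑ S, I.dual ε S * f S =
    ∑ j ∈ Finset.range (I.horizon ε),
      I.duration ε j * ∑ A ∈ I.active (I.state ε j), f A := by
  simp only [I.dual_eq_sum hε, Finset.sum_mul]
  rw [Finset.sum_comm]
  refine Finset.sum_congr rfl fun j _ => ?_
  simp only [ite_mul, zero_mul]
  rw [← Finset.sum_filter, Finset.mul_sum]
  congr 1
  ext; simp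

theorem mem_support_of_mem_active (hε : 0 < ε) {F : Finset (Sym2 V)} (hF : I.IsSolution F) {k : ℕ}
    {S : Finset V} (hS : S ∈ I.active (I.state ε k)) : S ∈ I.support ε := by
  have hk := I.lt_horizon_of_mem_active hε hF hS
  refine Finset.mem_filter.2 ⟨Finset.mem_univ _, ?_⟩
  rw [I.dual_eq_sum hε]
  refine Finset.sum_pos' (fun j hj => ?_) ⟨k, Finset.mem_range.2 hk, ?_⟩
  · have := (I.duration_pos hε (Finset.mem_range.1 hj)).le
    split_ifs <;> simp [this]
  · rw [if_pos hS]; exact I.duration_pos hε hk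

variable {I}

theorem mem_sep {U : Finset V} {d : Sym2 V} : d ∈ I.sep U ↔ d ∈ I.demands ∧ Separates U d := by
  simp [sep]

/-- This makes demand-activity a property of the set alone. Hence `y(𝒰_sep)` is the total growth of
demand-active components. -/
theorem mem_demandActive_iff {σ : State V} {S : Finset V} (hS : S ∈ I.comps σ) :
    S ∈ I.demandActive σ ↔ (I.sep S).Nonempty := by
  have hl : ∀ a ∈ S, ∀ b, Linked (I.tightEdges σ) a b ↔ b ∈ S := fun a ha b =>
    ⟨fun h => (mem_iff_mem_of_linked hS h).1 ha, linked_of_mem_components hS ha⟩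
  simp only [demandActive, Finset.mem_filter, hS, true_and]
  constructor
  · rintro ⟨a, ha, b, hab, hnl⟩
    exact ⟨_, mem_sep.2 ⟨hab, separates_mk.2 (Or.inl ⟨ha, by rwa [hl a ha] at hnl⟩)⟩⟩
  · rintro ⟨d, hd⟩
    obtain ⟨hd, hs⟩ := mem_sep.1 hd
    induction d with
    | _ a b =>
      rcases separates_mk.1 hs with h | h
      · exact ⟨a, h.1, b, hd, by rw [hl a h.1]; exact h.2⟩
      · exact ⟨b, h.2, a, by rwa [Sym2.eq_swap], by rw [hl b h.2]; exact h.1⟩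

variable (I)

theorem sepValue_eq (hε : 0 < ε) : I.sepValue ε = ∑ j ∈ Finset.range (I.horizon ε),
    I.duration ε j * ((I.demandActive (I.state ε j)).card : ℝ) := by
  have h1 : I.sepValue ε = ∑ S, I.dual ε S * if (I.sep S).Nonempty then 1 else 0 := by
    simp only [sepValue, sepSupport, support, Finset.filter_filter, mul_ite, mul_one, mul_zero]
    rw [← Finset.sum_filter]
    refine Finset.sum_subset (fun S hS => ?_) fun S hS hS' => ?_
    · simp only [Finset.mem_filter, Finset.mem_univ, true_and] at hS ⊢
      exact hS.2
    · simp only [Finset.mem_filter, Finset.mem_univ, true_and] at hS hS'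
      have := I.dual_nonneg hε S
      by_contra hne
      exact hS' ⟨lt_of_le_of_ne this (Ne.symm hne), hS⟩
  rw [h1, I.sum_dual hε]
  refine Finset.sum_congr rfl fun j _ => ?_
  rw [← Finset.sum_filter, Finset.sum_const, nsmul_eq_mul, mul_one]
  congr 3
  ext S
  simp only [Finset.mem_filter]
  constructor
  · rintro ⟨h1, h2⟩
    exact (mem_demandActive_iff (active_subset _ h1)).2 h2
  · intro h
    exact ⟨Finset.mem_union_left _ h, (mem_demandActive_iff (demandActive_subset _ h)).1 h⟩

/-- The part of the cost of `e` that the dual solution does not pay for. -/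
def slack (ε : ℝ) (e : Sym2 V) : ℝ := I.cost e - I.load (I.dual ε) e

theorem slack_nonneg (hε : 0 < ε) {e : Sym2 V} (he : e ∈ I.edges) : 0 ≤ I.slack ε e := by
  have h := (I.valid_state hε (I.horizon ε)).load_le e he
  have : I.dual ε = (I.state ε (I.horizon ε)).y := by
    ext S; rw [I.dual_eq_sum hε, I.y_horizon _ le_rfl]
  rw [slack, this]; linarith

/-- The cost of an edge set in terms of the dual solution. -/
theorem totalCost_eq (hε : 0 < ε) {F : Finset (Sym2 V)} (hF : F ⊆ I.edges) :
    I.totalCost F = ∑ e ∈ F, I.slack ε e + ∑ j ∈ Finset.range (I.horizon ε),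
      I.duration ε j * ∑ A ∈ I.active (I.state ε j), ((F.filter (Separates A)).card : ℝ) := by
  rw [← I.sum_dual hε]
  have : ∑ S, I.dual ε S * ((F.filter (Separates S)).card : ℝ) =
      ∑ e ∈ F, I.load (I.dual ε) e := by
    simp only [load, Finset.sum_filter, Finset.card_filter, Nat.cast_sum, Finset.mul_sum]
    rw [Finset.sum_comm]
    refine Finset.sum_congr rfl fun e he => Finset.sum_congr rfl fun S _ => ?_
    simp [mem_cut, hF he]
  rw [this, ← Finset.sum_add_distrib, totalCost]
  exact Finset.sum_congr rfl fun e _ => by rw [slack]; ring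

/-! ### Phases and points in time -/

theorem inPhase_iff {k : ℕ} (hk : k < I.horizon ε) {t : ℝ} :
    I.InPhase ε k t ↔ (I.state ε k).time ≤ t ∧ t < (I.state ε (k + 1)).time := by
  simp [InPhase, I.waits_nonempty_of_lt hk]

theorem inPhase_iff_of_le (hε : 0 < ε) {k : ℕ} (hk : I.horizon ε ≤ k) {t : ℝ} :
    I.InPhase ε k t ↔ (I.state ε (I.horizon ε)).time ≤ t := by
  rw [InPhase, I.state_eq_horizon hε hk]
  simp [I.waits_horizon hε]

theorem state_eq_of_inPhase (hε : 0 < ε) {j k : ℕ} {t : ℝ} (hj : I.InPhase ε j t)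
    (hk : I.InPhase ε k t) : I.state ε j = I.state ε k := by
  wlog hjk : j ≤ k generalizing j k
  · exact (this hk hj (by omega)).symm
  rcases hjk.eq_or_lt with rfl | hlt
  · rfl
  by_cases hjh : j < I.horizon ε
  · exfalso
    have h1 := ((I.inPhase_iff hjh).1 hj).2
    have h2 : (I.state ε (j + 1)).time ≤ (I.state ε k).time := by
      by_cases hkh : k ≤ I.horizon ε
      · exact I.time_le hε hlt hkh
      · rw [I.state_eq_horizon hε (k := k) (by omega)]
        exact I.time_le hε (by omega) le_rfl
    have := hk.1
    linarith
  · rw [I.state_eq_horizon hε (k := k) (by omega), I.state_eq_horizon hε (k := j) (by omega)]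

theorem activeAt_eq (hε : 0 < ε) {k : ℕ} {t : ℝ} (h : I.InPhase ε k t) :
    I.activeAt ε t = I.active (I.state ε k) := by
  ext S
  simp only [activeAt, Finset.mem_filter, Finset.mem_univ, true_and]
  constructor
  · rintro ⟨j, hj, hS⟩
    rwa [← I.state_eq_of_inPhase hε hj h]
  · exact fun hS => ⟨k, h, hS⟩

theorem inPhase_time (hε : 0 < ε) (k : ℕ) (hk : k ≤ I.horizon ε) :
    I.InPhase ε k (I.state ε k).time := by
  rcases hk.eq_or_lt with rfl | h
  · rw [I.inPhase_iff_of_le hε le_rfl]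
  · rw [I.inPhase_iff h]
    exact ⟨le_rfl, I.time_lt hε (by omega) h⟩

theorem exists_inPhase {t : ℝ} (ht : 0 ≤ t) (k : ℕ) (hk : k ≤ I.horizon ε)
    (htk : t < (I.state ε k).time) : ∃ j < k, I.InPhase ε j t := by
  induction k with
  | zero => simp [state, initial] at htk; linarith
  | succ k ih =>
    by_cases h : t < (I.state ε k).time
    · obtain ⟨j, hj, hp⟩ := ih (by omega) h
      exact ⟨j, by omega, hp⟩
    · exact ⟨k, by omega, (I.inPhase_iff (by omega)).2 ⟨not_lt.1 h, htk⟩⟩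

open MeasureTheory in
/-- The integral of a quantity that depends on the active components. -/
theorem integral_activeAt (hε : 0 < ε) {F : Finset (Sym2 V)} (hF : I.IsSolution F)
    (h : Finset (Finset V) → ℝ) (h0 : h ∅ = 0) :
    ∫ t in Set.Ioi (0 : ℝ), h (I.activeAt ε t) =
      ∑ j ∈ Finset.range (I.horizon ε), I.duration ε j * h (I.active (I.state ε j)) := by
  -- Phases are half-open intervals closed on the left, so time 0 is included at no cost.
  rw [← integral_Ici_eq_integral_Ioi]
  have hfun : ∀ t ∈ Set.Ici (0 : ℝ), h (I.activeAt ε t) = ∑ j ∈ Finset.range (I.horizon ε),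
      (Set.Ico (I.state ε j).time (I.state ε (j + 1)).time).indicator
        (fun _ => h (I.active (I.state ε j))) t := by
    intro t ht
    by_cases hend : t < (I.state ε (I.horizon ε)).time
    · obtain ⟨k, hk, hp⟩ := I.exists_inPhase ht _ le_rfl hend
      rw [Finset.sum_eq_single k, I.activeAt_eq hε hp, Set.indicator_of_mem]
      · exact (I.inPhase_iff hk).1 hp
      · intro j hj hjk
        refine Set.indicator_of_notMem (fun hmem => ?_) _
        have hjh := Finset.mem_range.1 hj
        have hp' := (I.inPhase_iff hjh).2 hmem
        have heq := congrArg State.time (I.state_eq_of_inPhase hε hp hp')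
        rcases lt_or_gt_of_ne hjk with hlt | hlt
        · exact absurd heq (I.time_lt hε hlt hk.le).ne'
        · exact absurd heq (I.time_lt hε hlt hjh.le).ne
      · intro hk'; exact absurd (Finset.mem_range.2 hk) hk'
    · push Not at hend
      rw [I.activeAt_eq hε ((I.inPhase_iff_of_le hε le_rfl).2 hend),
        I.active_eq_empty hε hF le_rfl, h0, Finset.sum_eq_zero]
      intro j hj
      refine Set.indicator_of_notMem (fun hmem => ?_) _
      have := I.time_le hε (j := j + 1) (k := I.horizon ε) (Finset.mem_range.1 hj) le_rfl
      have := hmem.2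
      linarith
  rw [setIntegral_congr_fun measurableSet_Ici hfun, integral_finsetSum]
  · refine Finset.sum_congr rfl fun j hj => ?_
    have hj' := Finset.mem_range.1 hj
    rw [setIntegral_indicator measurableSet_Ico]
    have : Set.Ici (0 : ℝ) ∩ Set.Ico (I.state ε j).time (I.state ε (j + 1)).time =
        Set.Ico (I.state ε j).time (I.state ε (j + 1)).time :=
      Set.inter_eq_right.2 fun t ht => (I.time_nonneg hε hj'.le).trans ht.1
    rw [this]
    have hle := I.time_le hε (j := j) (k := j + 1) (by omega) hj'
    simp [duration, hle]
  · intro j _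
    refine Integrable.integrableOn ?_
    rw [integrable_indicator_iff measurableSet_Ico]
    exact integrableOn_const (by simp)

theorem mergedCount_empty (𝒮 : Finset (Finset V)) : mergedCount ∅ 𝒮 = 0 := by
  have : IsEmpty (mergeGraph (∅ : Finset (Finset V)) 𝒮).ConnectedComponent :=
    ⟨fun c => c.ind fun v => absurd v.2 (Finset.notMem_empty _)⟩
  simp [mergedCount]

theorem gain_eq (hε : 0 < ε) {F : Finset (Sym2 V)} (hF : I.IsSolution F)
    (𝒮 : Finset (Finset V)) : I.gain ε 𝒮 = ∑ j ∈ Finset.range (I.horizon ε), I.duration ε j *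
      (2 * (((I.active (I.state ε j)).card : ℝ) - mergedCount (I.active (I.state ε j)) 𝒮)) := by
  rw [gain, I.integral_activeAt hε hF (fun 𝒜 => (𝒜.card : ℝ) - (mergedCount 𝒜 𝒮 : ℝ))]
  · rw [Finset.mul_sum]
    exact Finset.sum_congr rfl fun j _ => by ring
  · simp [mergedCount_empty]

end

section

variable (I : SteinerForestInstance V) (ε : ℝ)

/-! ### Components over time -/

theorem self_mem_comp (k : ℕ) (v : V) : v ∈ I.comp ε k v := self_mem_component _ v

theorem comp_mem_comps (k : ℕ) (v : V) : I.comp ε k v ∈ I.comps (I.state ε k) :=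
  component_mem_components _ v

theorem comp_mono {j k : ℕ} (h : j ≤ k) (v : V) : I.comp ε j v ⊆ I.comp ε k v :=
  component_mono (I.tightEdges_mono ε h) v

variable {I ε}

theorem eq_comp_of_mem {k : ℕ} {S : Finset V} (hS : S ∈ I.comps (I.state ε k)) {v : V}
    (hv : v ∈ S) : S = I.comp ε k v := eq_component_of_mem hS hv

theorem comp_eq_of_mem {k : ℕ} {u v : V} (h : u ∈ I.comp ε k v) : I.comp ε k u = I.comp ε k v :=
  (eq_comp_of_mem (I.comp_mem_comps ε k v) h).symm

theorem comp_eq_of_le {j k : ℕ} (hjk : j ≤ k) {u v : V} (h : I.comp ε j u = I.comp ε j v) :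
    I.comp ε k u = I.comp ε k v :=
  comp_eq_of_mem (I.comp_mono ε hjk v (h ▸ I.self_mem_comp ε j u))

variable (I ε)

/-- All vertices of `T` lie in the same component after the `k`-th event. -/
def Finished (k : ℕ) (T : Finset V) : Prop := ∃ C ∈ I.comps (I.state ε k), T ⊆ C

variable {I ε}

theorem Finished.mono {j k : ℕ} (hjk : j ≤ k) {T : Finset V} (hT : T.Nonempty)
    (h : I.Finished ε j T) : I.Finished ε k T := by
  obtain ⟨C, hC, hTC⟩ := h
  obtain ⟨v, hv⟩ := hT
  refine ⟨I.comp ε k v, I.comp_mem_comps ε k v, ?_⟩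
  rw [eq_comp_of_mem hC (hTC hv)] at hTC
  exact hTC.trans (I.comp_mono ε hjk v)

theorem not_finished {k : ℕ} {T : Finset V} {a b : V} (ha : a ∈ T) (hb : b ∈ T)
    (h : b ∉ I.comp ε k a) : ¬ I.Finished ε k T := by
  rintro ⟨C, hC, hTC⟩
  rw [eq_comp_of_mem hC (hTC ha)] at hTC
  exact h (hTC hb)

theorem comp_mem_demandActive {j k : ℕ} (hjk : j ≤ k) {a b : V} (hab : s(a, b) ∈ I.demands)
    (h : b ∉ I.comp ε k a) : I.comp ε j a ∈ I.demandActive (I.state ε j) :=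
  (mem_demandActive_iff (I.comp_mem_comps ε j a)).2 ⟨s(a, b), mem_sep.2 ⟨hab,
    separates_mk.2 (Or.inl ⟨I.self_mem_comp ε j a, fun hb => h (I.comp_mono ε hjk a hb)⟩)⟩⟩

theorem comp_mem_active {j k : ℕ} (hjk : j ≤ k) {a b : V} (hab : s(a, b) ∈ I.demands)
    (h : b ∉ I.comp ε k a) : I.comp ε j a ∈ I.active (I.state ε j) :=
  Finset.mem_union_left _ (comp_mem_demandActive hjk hab h)

theorem not_mem_comp_symm {k : ℕ} {a b : V} (h : b ∉ I.comp ε k a) : a ∉ I.comp ε k b :=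
  fun ha => h (comp_eq_of_mem ha ▸ I.self_mem_comp ε k b)

variable (I ε)

/-- The vertices of `T` that are active until all of `T` lies in one component. -/
def late (T : Finset V) : Finset V :=
  T.filter fun v => ∀ j, ¬ I.Finished ε j T → I.comp ε j v ∈ I.active (I.state ε j)

variable {I ε}

theorem late_subset (T : Finset V) : I.late ε T ⊆ T := Finset.filter_subset _ _

theorem comp_active_of_mem_late {T : Finset V} {v : V} (hv : v ∈ I.late ε T) {j : ℕ}
    (hj : ¬ I.Finished ε j T) : I.comp ε j v ∈ I.active (I.state ε j) :=
  (Finset.mem_filter.1 hv).2 j hj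

/-- As long as `b` is apart from `a`, the demand keeps it active; afterwards it shares the component
of `a`. -/
theorem mem_late_of_demand {T : Finset V} {a b : V} (hab : s(a, b) ∈ I.demands) (hb : b ∈ T)
    (ha : a ∈ I.late ε T) : b ∈ I.late ε T := by
  refine Finset.mem_filter.2 ⟨hb, fun j hj => ?_⟩
  by_cases h : b ∈ I.comp ε j a
  · rw [comp_eq_of_mem h]; exact comp_active_of_mem_late ha hj
  · exact comp_mem_active le_rfl (by rwa [Sym2.eq_swap]) (not_mem_comp_symm h)

/-- Up to phase `k` the unsatisfied demand keeps `a` active; from then on `a` shares the component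
of the late vertex `v`. -/
theorem mem_late_of_separates {T : Finset V} {k : ℕ} {v a b : V} (hv : v ∈ I.late ε T)
    (hva : v ∈ I.comp ε k a) (hab : s(a, b) ∈ I.demands) (hb : b ∉ I.comp ε k a) (ha : a ∈ T) :
    a ∈ I.late ε T := by
  refine Finset.mem_filter.2 ⟨ha, fun j hj => ?_⟩
  rcases le_total j k with hjk | hjk
  · exact comp_mem_active hjk hab hb
  · rw [← comp_eq_of_le hjk (comp_eq_of_mem hva)]; exact comp_active_of_mem_late hv hj

/-- The late vertices are actively connected. -/
theorem activelyConnectedSet_late (hε : 0 < ε) {F : Finset (Sym2 V)} (hF : I.IsSolution F)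
    {T : Finset V} (hT : T.Nonempty) : I.ActivelyConnectedSet ε (I.late ε T) := by
  rcases (I.late ε T).eq_empty_or_nonempty with h0 | ⟨v, hv⟩
  · obtain ⟨v, -⟩ := hT
    exact ⟨v, by simp [h0]⟩
  have hfin : I.Finished ε (I.horizon ε) T := by
    by_contra h
    have := comp_active_of_mem_late hv h
    simp [I.active_eq_empty hε hF le_rfl] at this
  -- The witness for active connectivity is the first moment at which `T` lies in one component:
  -- late vertices are active throughout the time before it.
  have hex : ∃ k, I.Finished ε k T := ⟨_, hfin⟩
  set k := Nat.find hex
  have hk : I.Finished ε k T := Nat.find_spec hex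
  have hkK : k ≤ I.horizon ε := Nat.find_min' hex hfin
  have hdeact : ∀ u ∈ I.late ε T, (I.state ε k).time ≤ I.deactivationTime ε u := by
    intro u hu
    refine le_csSup ⟨(I.state ε (I.horizon ε)).time, ?_⟩ ⟨I.time_nonneg hε hkK, ?_⟩
    · rintro t ⟨-, ht⟩
      by_contra! hlt
      obtain ⟨S, hS, -⟩ := ht _ (I.time_nonneg hε le_rfl) hlt
      rw [I.activeAt_eq hε (I.inPhase_time hε _ le_rfl), I.active_eq_empty hε hF le_rfl] at hS
      simp at hS
    · intro s hs0 hs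
      obtain ⟨j, hj, hp⟩ := I.exists_inPhase hs0 k hkK hs
      refine ⟨I.comp ε j u, ?_, I.self_mem_comp ε j u⟩
      rw [I.activeAt_eq hε hp]
      exact comp_active_of_mem_late hu (Nat.find_min hex hj)
  refine ⟨v, fun u hu => ⟨(I.state ε k).time, I.time_nonneg hε hkK, ?_, hdeact v hv, hdeact u hu⟩⟩
  obtain ⟨C, hC, hTC⟩ := hk
  refine ⟨C, ?_, hTC (late_subset T hv), hTC (late_subset T hu)⟩
  exact Finset.mem_filter.2 ⟨Finset.mem_univ _, k, I.inPhase_time hε k hkK, hC⟩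

/-! ### The number of edges of a solution in a cut -/

/-- The number of edges of `F` that `U` separates. -/
def crossings (F : Finset (Sym2 V)) (U : Finset V) : ℕ := (F.filter (Separates U)).card

theorem crossings_mono {F F' : Finset (Sym2 V)} (h : F ⊆ F') (U : Finset V) :
    crossings F U ≤ crossings F' U := Finset.card_le_card (Finset.filter_subset_filter _ h)

theorem inner_subset (F : Finset (Sym2 V)) (T : Finset V) : inner F T ⊆ F :=
  Finset.filter_subset _ _

theorem Linked.crossings_pos {F : Finset (Sym2 V)} {U : Finset V} {u v : V} (h : Linked F u v)
    (hu : u ∈ U) (hv : v ∉ U) : 1 ≤ crossings F U := by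
  obtain ⟨e, he, hs⟩ := h.exists_separates hu hv
  exact Finset.card_pos.2 ⟨e, Finset.mem_filter.2 ⟨he, hs⟩⟩

theorem crossings_pos_of_not_finished {F : Finset (Sym2 V)} {T : Finset V}
    (hT : T ∈ components F) {k : ℕ} (hk : ¬ I.Finished ε k T) {A : Finset V}
    (hA : A ∈ I.comps (I.state ε k)) {v : V} (hv : v ∈ A) (hvT : v ∈ T) :
    1 ≤ crossings (inner F T) A := by
  obtain ⟨w, hw, hwA⟩ : ∃ w ∈ T, w ∉ A := by
    by_contra! h
    exact hk ⟨A, hA, h⟩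
  exact (linked_inner hT hvT (linked_of_mem_components hT hvT hw)).crossings_pos hv hwA

theorem crossings_eq_zero_of_finished {F : Finset (Sym2 V)} {T : Finset V} {k : ℕ}
    (hk : I.Finished ε k T) {A : Finset V} (hA : A ∈ I.comps (I.state ε k)) :
    crossings (inner F T) A = 0 := by
  obtain ⟨C, hC, hTC⟩ := hk
  refine Finset.card_eq_zero.2 (Finset.filter_eq_empty_iff.2 fun e he hs => ?_)
  have h2 := (Finset.mem_filter.1 he).2
  obtain ⟨⟨a, ha, haA⟩, b, hb, hbA⟩ := hs
  have := eq_of_mem_components hA hC haA (hTC (h2 a ha))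
  exact hbA (this ▸ hTC (h2 b hb))

theorem crossings_pos_of_demandActive {F : Finset (Sym2 V)} (hF : I.IsSolution F) {σ : State V}
    {A : Finset V} (hA : A ∈ I.demandActive σ) : 1 ≤ crossings F A := by
  obtain ⟨hAc, a, ha, b, hab, hl⟩ := Finset.mem_filter.1 hA
  exact (hF.2 a b hab).crossings_pos ha fun hb => hl (linked_of_mem_components hAc ha hb)

/-- An optimal solution cannot leave a budget-active component by a single edge. -/
theorem crossings_ne_one_of_budgetActive (hε : 0 < ε) {F : Finset (Sym2 V)} (hF : I.IsOptimal F)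
    {k : ℕ} {B : Finset V} (hB : B ∈ I.budgetActive (I.state ε k)) : crossings F B ≠ 1 := by
  intro h1
  obtain ⟨e, he⟩ := Finset.card_eq_one.1 h1
  obtain ⟨heF, hes⟩ : e ∈ F ∧ Separates B e := by
    rw [← Finset.mem_filter, he]; simp
  have heE := hF.1.1 heF
  have hBc := budgetActive_subset _ hB
  have hsep : I.sep B = ∅ := by
    by_contra h
    exact (Finset.mem_filter.1 hB).2.1
      ((mem_demandActive_iff hBc).2 (Finset.nonempty_iff_ne_empty.2 h))
  have hsol : I.IsSolution (F.erase e) := by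
    refine ⟨(Finset.erase_subset _ _).trans hF.1.1, fun a b hab => ?_⟩
    refine (hF.1.2 a b hab).erase he ?_
    have : s(a, b) ∉ I.sep B := by simp [hsep]
    rw [mem_sep, separates_mk] at this
    tauto
  -- Optimality makes the superfluous edge free. Its load lies between 0 and its cost, so it is
  -- tight and cannot leave a component.
  have h2 := hF.2 _ hsol
  have h3 : I.totalCost (F.erase e) + I.cost e = I.totalCost F := Finset.sum_erase_add _ _ heF
  have h4 : 0 ≤ I.load (I.state ε k).y e := by
    refine Finset.sum_nonneg fun S _ => ?_
    have hkK := I.lt_horizon_of_mem_active hε hF.1 (Finset.mem_union_right _ hB)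
    rw [I.y_horizon k hkK.le]
    refine Finset.sum_nonneg fun j hj => ?_
    have := (I.duration_pos hε ((Finset.mem_range.1 hj).trans hkK)).le
    split_ifs <;> simp [this]
  have h5 := (I.valid_state hε k).load_le e heE
  have h6 : e ∈ I.tightEdges (I.state ε k) := Finset.mem_filter.2 ⟨heE, by linarith⟩
  exact not_separates_of_mem_components hBc h6 hes

/-! ### Prematurely deactivated sets are paid by budgets -/

variable (I ε)

/-- The demand-active components in phase `k` that contain no late vertex of a component of
`(V, F)` that is still to be connected. -/
def premature (F : Finset (Sym2 V)) (k : ℕ) : Finset (Finset V) :=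
  (I.demandActive (I.state ε k)).filter fun A =>
    ∀ T ∈ components F, ¬ I.Finished ε k T → Disjoint A (I.late ε T)

/-- The growth of premature sets inside `C` that have always been active since then. -/
def unresolved (F : Finset (Sym2 V)) : ℕ → Finset V → ℝ
  | 0, _ => 0
  | k + 1, C => ∑ S ∈ (I.comps (I.state ε k)).filter (· ⊆ C),
      if S ∈ I.active (I.state ε k) then
        unresolved F k S + if S ∈ I.premature ε F k then I.duration ε k else 0
      else 0

/-- Components only merge, so each old one lies in exactly one new one. -/
theorem sum_comps_succ (k : ℕ) (f : Finset V → ℝ) :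
    ∑ C ∈ I.comps (I.state ε (k + 1)), ∑ S ∈ (I.comps (I.state ε k)).filter (· ⊆ C), f S =
      ∑ S ∈ I.comps (I.state ε k), f S := by
  rw [← Finset.sum_biUnion]
  · refine Finset.sum_congr ?_ fun _ _ => rfl
    ext S
    simp only [Finset.mem_biUnion, Finset.mem_filter]
    refine ⟨fun ⟨_, _, h, _⟩ => h, fun hS => ?_⟩
    obtain ⟨v, hv⟩ := nonempty_of_mem_components hS
    refine ⟨I.comp ε (k + 1) v, I.comp_mem_comps ε _ v, hS, ?_⟩
    rw [eq_comp_of_mem hS hv]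
    exact I.comp_mono ε (Nat.le_succ k) v
  · intro C hC C' hC' hne
    refine Finset.disjoint_left.2 fun S hS hS' => hne ?_
    obtain ⟨hS1, hS2⟩ := Finset.mem_filter.1 hS
    obtain ⟨v, hv⟩ := nonempty_of_mem_components hS1
    exact eq_of_mem_components hC hC' (hS2 hv) ((Finset.mem_filter.1 hS').2 hv)

/-- A nonzero value is traced back through the recursion. Its value is reset to zero in any inactive
component, so the premature set found has been inside active components in all phases since. -/
theorem exists_premature_of_unresolved (F : Finset (Sym2 V)) (k : ℕ) (C : Finset V)
    (h : I.unresolved ε F k C ≠ 0) : ∃ j < k, ∃ A ∈ I.premature ε F j, A ⊆ C ∧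
      ∀ i, j ≤ i → i < k → ∃ C' ∈ I.active (I.state ε i), A ⊆ C' := by
  induction k generalizing C with
  | zero => exact absurd rfl h
  | succ k ih =>
    rw [unresolved] at h
    obtain ⟨S, hS, hne⟩ := Finset.exists_ne_zero_of_sum_ne_zero h
    obtain ⟨hS, hSC⟩ := Finset.mem_filter.1 hS
    split_ifs at hne with h1 h2
    · exact ⟨k, by omega, S, h2, hSC, fun i h3 h4 => ⟨S, by rwa [show i = k by omega], subset_rfl⟩⟩
    · rw [add_zero] at hne
      obtain ⟨j, hj, A, hA, hAS, hact⟩ := ih S hne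
      refine ⟨j, by omega, A, hA, hAS.trans hSC, fun i h3 h4 => ?_⟩
      rcases Nat.lt_succ_iff_lt_or_eq.1 h4 with h5 | rfl
      · exact hact i h3 h5
      · exact ⟨S, h1, hAS⟩
    · exact absurd rfl hne

/-- Unresolved growth in `C` forces `F` to leave `C`. It comes from a premature set with an
unsatisfied demand vertex `a` that is not late, so `a` becomes inactive while its component of `(V,
F)` is unfinished. This happens only in phase `k` or later: first the demand keeps `a` active, then
membership in active components does. So that component is still unfinished in phase `k`. -/
theorem unresolved_eq_zero {F : Finset (Sym2 V)} (hF : I.IsSolution F) {k : ℕ} {C : Finset V}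
    (hC : C ∈ I.comps (I.state ε k)) (h0 : crossings F C = 0) : I.unresolved ε F k C = 0 := by
  by_contra hne
  obtain ⟨j, hjk, A, hA, hAC, hact⟩ := I.exists_premature_of_unresolved ε F k C hne
  obtain ⟨hA, hprem⟩ := Finset.mem_filter.1 hA
  obtain ⟨hAc, a, ha, b, hab, hl⟩ := Finset.mem_filter.1 hA
  have hb : b ∉ I.comp ε j a := by
    rw [← eq_comp_of_mem hAc ha]
    exact fun hb => hl (linked_of_mem_components hAc ha hb)
  have haT : a ∈ component F a := self_mem_component F a
  have hbT : b ∈ component F a := by simpa using hF.2 a b hab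
  have hT := component_mem_components F a
  have halate : a ∉ I.late ε (component F a) :=
    Finset.disjoint_left.1 (hprem _ hT (not_finished haT hbT hb)) ha
  have : ∃ i, ¬ I.Finished ε i (component F a) ∧ I.comp ε i a ∉ I.active (I.state ε i) := by
    by_contra! h
    exact halate (Finset.mem_filter.2 ⟨haT, h⟩)
  obtain ⟨i, hi, hina⟩ := this
  have hki : k ≤ i := by
    by_contra! hik
    rcases le_total i j with hij | hij
    · exact hina (comp_mem_active hij hab hb)
    · obtain ⟨C', hC', hAC'⟩ := hact i hij hik
      rw [eq_comp_of_mem (active_subset _ hC') (hAC' ha)] at hC'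
      exact hina hC'
  have hk : ¬ I.Finished ε k (component F a) := fun h => hi (h.mono hki ⟨a, haT⟩)
  have := crossings_pos_of_not_finished hT hk hC (hAC ha) haT
  have := crossings_mono (inner_subset F (component F a)) C
  omega

variable {ε}

/-- Resolved premature growth has been paid by spent budget, and the maxima record what is already
spent on unresolved growth. The right side counts only spending by components that `F` leaves. When
a component becomes inactive its budget is zero, so its whole unresolved amount is in the maximum
and can be moved to the resolved part. -/
theorem premature_invariant (hε : 0 < ε) {F : Finset (Sym2 V)} (hF : I.IsSolution F) (k : ℕ)
    (hk : k ≤ I.horizon ε) :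
    ε * (∑ j ∈ Finset.range k, I.duration ε j * ((I.premature ε F j).card : ℝ) -
        ∑ C ∈ I.comps (I.state ε k), I.unresolved ε F k C) +
      ∑ C ∈ I.comps (I.state ε k),
        max 0 (ε * I.unresolved ε F k C - (I.state ε k).budget C) ≤
    ∑ j ∈ Finset.range k, I.duration ε j *
      (((I.budgetActive (I.state ε j)).filter fun B => 1 ≤ crossings F B).card : ℝ) := by
  induction k with
  | zero => simp [unresolved, state, initial]
  | succ k ih =>
    have ih := ih (by omega)
    set σ := I.state ε k with hσ
    set Δ := I.duration ε k with hΔ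
    have hΔpos : 0 < Δ := I.duration_pos hε (by omega)
    have hvalid : I.Valid σ := I.valid_state hε k
    set g : Finset V → ℝ := fun S => if S ∈ I.active σ then
        I.unresolved ε F k S + if S ∈ I.premature ε F k then Δ else 0
      else 0 with hg
    have hU : ∀ C, I.unresolved ε F (k + 1) C = ∑ S ∈ (I.comps σ).filter (· ⊆ C), g S :=
      fun C => rfl
    have hb : ∀ C, (I.state ε (k + 1)).budget C =
        ∑ S ∈ (I.comps σ).filter (· ⊆ C), I.grownBudget ε σ Δ S := fun C => by
      rw [I.state_succ_eq_grow (by omega)]; rfl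
    have h1 : ∑ C ∈ I.comps (I.state ε (k + 1)), I.unresolved ε F (k + 1) C =
        ∑ S ∈ I.comps σ, g S := by
      simp only [hU]; exact I.sum_comps_succ ε k g
    -- Merging adds both budgets and unresolved amounts, and `max 0` is subadditive.
    have h2 : ∑ C ∈ I.comps (I.state ε (k + 1)),
        max 0 (ε * I.unresolved ε F (k + 1) C - (I.state ε (k + 1)).budget C) ≤
        ∑ S ∈ I.comps σ, max 0 (ε * g S - I.grownBudget ε σ Δ S) := by
      rw [← I.sum_comps_succ ε k]
      refine Finset.sum_le_sum fun C _ => ?_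
      rw [hU, hb, Finset.mul_sum, ← Finset.sum_sub_distrib]
      exact max_le (Finset.sum_nonneg fun S _ => le_max_left _ _)
        (Finset.sum_le_sum fun S _ => le_max_right _ _)
    -- One old component at a time. A demand-active one earns at least as much as its unresolved
    -- amount costs. A spending one is charged if `F` leaves it and otherwise has nothing
    -- unresolved. An inactive one has no budget and resolves everything.
    have h3 : ∀ S ∈ I.comps σ, ε * ((if S ∈ I.premature ε F k then Δ else 0) - g S +
        I.unresolved ε F k S) + max 0 (ε * g S - I.grownBudget ε σ Δ S) ≤
        max 0 (ε * I.unresolved ε F k S - σ.budget S) +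
          if S ∈ (I.budgetActive σ).filter (fun B => 1 ≤ crossings F B) then Δ else 0 := by
      intro S hS
      have hdisj := disjoint_demandActive_budgetActive (I := I) σ
      by_cases hD : S ∈ I.demandActive σ
      · have hB : S ∉ I.budgetActive σ := Finset.disjoint_left.1 hdisj hD
        have hA : S ∈ I.active σ := Finset.mem_union_left _ hD
        simp only [hg, if_pos hA, grownBudget, if_pos hD, Finset.mem_filter, hB, false_and,
          if_false, add_zero]
        have := mul_pos hε hΔpos
        split_ifs
        · rw [show ε * (Δ - (I.unresolved ε F k S + Δ) + I.unresolved ε F k S) = 0 by ring]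
          rw [zero_add]
          exact max_le_max le_rfl (by linarith)
        · rw [show ε * (0 - (I.unresolved ε F k S + 0) + I.unresolved ε F k S) = 0 by ring]
          rw [zero_add]
          exact max_le_max le_rfl (by linarith)
      have hP : S ∉ I.premature ε F k := fun h => hD (Finset.mem_filter.1 h).1
      by_cases hB : S ∈ I.budgetActive σ
      · have hA : S ∈ I.active σ := Finset.mem_union_right _ hB
        have hgr := grownBudget_nonneg hε hvalid hΔpos.le
          (I.duration_mem_waits (k := k) (by omega)).2 hS
        simp only [hg, if_pos hA, if_neg hP, Finset.mem_filter, hB, true_and]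
        rw [show ε * (0 - (I.unresolved ε F k S + 0) + I.unresolved ε F k S) = 0 by ring,
          zero_add, add_zero]
        by_cases hc : 1 ≤ crossings F S
        · rw [if_pos hc, grownBudget, if_neg hD, if_pos hB]
          have h4 := le_max_left 0 (ε * I.unresolved ε F k S - σ.budget S)
          have h5 := le_max_right 0 (ε * I.unresolved ε F k S - σ.budget S)
          exact max_le (by linarith) (by linarith)
        · rw [I.unresolved_eq_zero ε hF hS (by omega), if_neg hc, mul_zero, add_zero]
          exact max_le (le_max_left _ _) ((by linarith : _ ≤ (0 : ℝ)).trans (le_max_left _ _))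
      · have hA : S ∉ I.active σ := fun h => (Finset.mem_union.1 h).elim hD hB
        have hb0 : σ.budget S ≤ 0 := by
          by_contra! h
          exact hB (Finset.mem_filter.2 ⟨hS, hD, h⟩)
        have hb1 := hvalid.budget_nonneg S hS
        simp only [hg, if_neg hA, if_neg hP, grownBudget, if_neg hD, Finset.mem_filter,
          hB, false_and, if_false]
        have : σ.budget S = 0 := le_antisymm hb0 hb1
        rw [this]
        simp
    have h4 := Finset.sum_le_sum h3
    simp only [Finset.sum_add_distrib, Finset.sum_sub_distrib, ← Finset.mul_sum] at h4
    have hcount : ∀ X ⊆ I.comps σ, ∑ S ∈ I.comps σ, (if S ∈ X then Δ else 0) = Δ * (X.card : ℝ) := by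
      intro X hX
      rw [Finset.sum_ite_mem, Finset.inter_eq_right.2 hX, Finset.sum_const, nsmul_eq_mul, mul_comm]
    rw [hcount (I.premature ε F k) ((Finset.filter_subset _ _).trans (demandActive_subset σ)),
      hcount _ ((Finset.filter_subset _ _).trans (budgetActive_subset σ))] at h4
    rw [Finset.sum_range_succ, Finset.sum_range_succ, h1]
    rw [mul_add, mul_sub] at h4
    rw [mul_sub] at ih
    rw [mul_sub, mul_add]
    linarith

/-- At the horizon nothing is active and no budget is left, so the invariant covers all premature
growth. The factor 2 comes from `crossings_ne_one_of_budgetActive`: a budget-active component that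
`F` leaves is crossed at least twice. -/
theorem premature_le (hε : 0 < ε) {F : Finset (Sym2 V)} (hF : I.IsOptimal F) :
    ∑ j ∈ Finset.range (I.horizon ε), I.duration ε j * ((I.premature ε F j).card : ℝ) ≤
      1 / (2 * ε) * ∑ j ∈ Finset.range (I.horizon ε), I.duration ε j *
        ∑ B ∈ I.budgetActive (I.state ε j), (crossings F B : ℝ) := by
  have h := I.premature_invariant hε hF.1 _ le_rfl
  set K := I.horizon ε
  have h1 : ε * ∑ C ∈ I.comps (I.state ε K), I.unresolved ε F K C ≤
      ∑ C ∈ I.comps (I.state ε K),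
        max 0 (ε * I.unresolved ε F K C - (I.state ε K).budget C) := by
    rw [Finset.mul_sum]
    refine Finset.sum_le_sum fun C hC => le_max_of_le_right ?_
    have hina : C ∉ I.active (I.state ε K) := by simp [I.active_eq_empty hε hF.1 le_rfl, K]
    have : (I.state ε K).budget C ≤ 0 := by
      by_contra! hpos
      have hD : C ∉ I.demandActive (I.state ε K) := fun h => hina (Finset.mem_union_left _ h)
      exact hina (Finset.mem_union_right _ (Finset.mem_filter.2 ⟨hC, hD, hpos⟩))
    linarith
  have h2 : 2 * ∑ j ∈ Finset.range K, I.duration ε j *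
      (((I.budgetActive (I.state ε j)).filter fun B => 1 ≤ crossings F B).card : ℝ) ≤
      ∑ j ∈ Finset.range K, I.duration ε j *
        ∑ B ∈ I.budgetActive (I.state ε j), (crossings F B : ℝ) := by
    rw [Finset.mul_sum]
    refine Finset.sum_le_sum fun j hj => ?_
    rw [mul_left_comm]
    refine mul_le_mul_of_nonneg_left ?_ (I.duration_pos hε (Finset.mem_range.1 hj)).le
    rw [Finset.card_filter, Nat.cast_sum, Finset.mul_sum]
    refine Finset.sum_le_sum fun B hB => ?_
    have := crossings_ne_one_of_budgetActive hε hF hB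
    split_ifs with h1
    · have : 2 ≤ crossings F B := by omega
      simpa using (by exact_mod_cast this : (2 : ℝ) ≤ crossings F B)
    · simp
  rw [mul_sub] at h
  rw [one_div, inv_mul_eq_div, le_div_iff₀ (by positivity)]
  linarith

end

section

variable (I : SteinerForestInstance V) (ε : ℝ)

/-! ### Late vertices and active components -/

theorem sum_card_filter_comm {α β : Type*} (s : Finset α) (t : Finset β) (r : α → β → Prop)
    [∀ a b, Decidable (r a b)] :
    ∑ a ∈ s, (t.filter fun b => r a b).card = ∑ b ∈ t, (s.filter fun a => r a b).card := by
  simp only [Finset.card_filter]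
  exact Finset.sum_comm

/-- The components `T` of `(V, F)` with late vertices that are not yet inside one component. -/
def pending (F : Finset (Sym2 V)) (k : ℕ) : Finset (Finset V) :=
  (components F).filter fun T => ¬ I.Finished ε k T ∧ (I.late ε T).Nonempty

/-- The set `A` contains a late vertex of `T`. -/
def Meets (T A : Finset V) : Prop := ∃ v ∈ I.late ε T, v ∈ A

/-- The active components that contain late vertices of `T`. -/
def lateComps (k : ℕ) (T : Finset V) : Finset (Finset V) :=
  (I.active (I.state ε k)).filter (I.Meets ε T)

/-- The active components that contain late vertices of some pending component. -/
def lateActive (F : Finset (Sym2 V)) (k : ℕ) : Finset (Finset V) :=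
  (I.active (I.state ε k)).filter fun A => ∃ T ∈ I.pending ε F k, I.Meets ε T A

/-- The set `A` is demand-active and crossed by only one edge of `F`. -/
def Clean (F : Finset (Sym2 V)) (k : ℕ) (A : Finset V) : Prop :=
  A ∈ I.demandActive (I.state ε k) ∧ crossings F A = 1

/-- The contribution of one unit of growth of `A` to the excess of `F`. -/
def surplus (F : Finset (Sym2 V)) (k : ℕ) (A : Finset V) : ℕ :=
  if A ∈ I.demandActive (I.state ε k) then crossings F A - 1 else crossings F A

variable {I ε}

theorem excess_eq (hε : 0 < ε) {F : Finset (Sym2 V)} (hF : I.IsSolution F) :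
    I.excess ε F = ∑ e ∈ F, I.slack ε e + ∑ j ∈ Finset.range (I.horizon ε),
      I.duration ε j * ∑ A ∈ I.active (I.state ε j), (I.surplus ε F j A : ℝ) := by
  rw [excess, I.totalCost_eq hε hF.1, I.sepValue_eq hε, add_sub_assoc, ← Finset.sum_sub_distrib]
  congr 1
  refine Finset.sum_congr rfl fun j _ => ?_
  rw [← mul_sub]
  congr 1
  have h1 : ((I.demandActive (I.state ε j)).card : ℝ) = ∑ A ∈ I.active (I.state ε j),
      if A ∈ I.demandActive (I.state ε j) then 1 else 0 := by
    rw [Finset.sum_ite_mem, active, Finset.inter_eq_right.2 Finset.subset_union_left]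
    simp
  rw [h1, ← Finset.sum_sub_distrib]
  refine Finset.sum_congr rfl fun A _ => ?_
  rw [surplus]
  split_ifs with h
  · have := crossings_pos_of_demandActive hF h
    push_cast [this]; rfl
  · simp [crossings]

theorem comp_mem_lateComps {k : ℕ} {T : Finset V} (hk : ¬ I.Finished ε k T) {v : V}
    (hv : v ∈ I.late ε T) : I.comp ε k v ∈ I.lateComps ε k T :=
  Finset.mem_filter.2 ⟨comp_active_of_mem_late hv hk, v, hv, I.self_mem_comp ε k v⟩

theorem mem_comps_of_mem_lateComps {k : ℕ} {T A : Finset V} (h : A ∈ I.lateComps ε k T) :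
    A ∈ I.comps (I.state ε k) := active_subset _ (Finset.mem_filter.1 h).1

theorem card_demandActive_le (F : Finset (Sym2 V)) (k : ℕ) :
    (I.demandActive (I.state ε k)).card ≤
      (I.premature ε F k).card + (I.lateActive ε F k).card := by
  refine (Finset.card_le_card fun A hA => ?_).trans (Finset.card_union_le _ _)
  by_cases h : A ∈ I.premature ε F k
  · exact Finset.mem_union_left _ h
  · refine Finset.mem_union_right _ (Finset.mem_filter.2 ⟨Finset.mem_union_left _ hA, ?_⟩)
    simp only [premature, Finset.mem_filter, hA, true_and] at h
    push Not at h
    obtain ⟨T, hT, hk, hd⟩ := h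
    obtain ⟨v, hvA, hv⟩ := Finset.not_disjoint_iff.1 hd
    exact ⟨T, Finset.mem_filter.2 ⟨hT, hk, v, hv⟩, v, hv, hvA⟩

/-- The late vertices of pending components merge the active components containing them. -/
theorem mergedCount_late_le (F : Finset (Sym2 V)) (k : ℕ) :
    mergedCount (I.active (I.state ε k)) ((components F).image (I.late ε)) +
        (I.lateActive ε F k).card ≤
      (I.active (I.state ε k)).card + (I.pending ε F k).card := by
  set 𝒜 := I.active (I.state ε k)
  set L := I.lateActive ε F k
  have hLA : L ⊆ 𝒜 := Finset.filter_subset _ _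
  have hex : ∀ T : {T // T ∈ I.pending ε F k}, ∃ A : {A // A ∈ 𝒜}, I.Meets ε T.1 A.1 := by
    rintro ⟨T, hT⟩
    obtain ⟨-, hk, v, hv⟩ := Finset.mem_filter.1 hT
    exact ⟨⟨I.comp ε k v, comp_active_of_mem_late hv hk⟩, v, hv, I.self_mem_comp ε k v⟩
  choose g hg using hex
  -- The merged classes are exhausted by the active sets outside `L`, each standing for itself, and
  -- by one class for each pending `T`, whose late vertices form a single member of the collection.
  let f : {A // A ∈ 𝒜 \ L} ⊕ {T // T ∈ I.pending ε F k} →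
      (mergeGraph 𝒜 ((components F).image (I.late ε))).ConnectedComponent :=
    Sum.elim (fun A => SimpleGraph.connectedComponentMk _ ⟨A.1, (Finset.mem_sdiff.1 A.2).1⟩)
      fun T => SimpleGraph.connectedComponentMk _ (g T)
  have hf : Function.Surjective f := by
    intro c
    induction c using SimpleGraph.ConnectedComponent.ind with
    | h A =>
      by_cases hA : A.1 ∈ L
      · obtain ⟨-, T, hT, v, hv, hvA⟩ := Finset.mem_filter.1 hA
        refine ⟨Sum.inr ⟨T, hT⟩, ?_⟩
        simp only [f, Sum.elim_inr, SimpleGraph.ConnectedComponent.eq]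
        by_cases heq : g ⟨T, hT⟩ = A
        · rw [heq]
        · refine SimpleGraph.Adj.reachable ?_
          rw [mergeGraph, SimpleGraph.fromRel_adj]
          obtain ⟨w, hw, hwA⟩ := hg ⟨T, hT⟩
          exact ⟨heq, Or.inl ⟨I.late ε T, Finset.mem_image_of_mem _ (Finset.mem_filter.1 hT).1,
            ⟨w, Finset.mem_inter.2 ⟨hw, hwA⟩⟩, ⟨v, Finset.mem_inter.2 ⟨hv, hvA⟩⟩⟩⟩
      · exact ⟨Sum.inl ⟨A.1, Finset.mem_sdiff.2 ⟨A.2, hA⟩⟩, rfl⟩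
  have h1 := Nat.card_le_card_of_surjective f hf
  rw [Nat.card_eq_fintype_card (α := _ ⊕ _), Fintype.card_sum, Fintype.card_coe,
    Fintype.card_coe, Finset.card_sdiff_of_subset hLA] at h1
  have h2 := Finset.card_le_card hLA
  change mergedCount 𝒜 _ ≤ _ at h1
  omega

theorem crossings_inner_sum_le (F : Finset (Sym2 V)) (𝒯 : Finset (Finset V))
    (h𝒯 : 𝒯 ⊆ components F) (G : Finset V → Finset (Sym2 V)) (hG : ∀ T ∈ 𝒯, G T ⊆ inner F T)
    (U : Finset V) : ∑ T ∈ 𝒯, crossings (G T) U ≤ crossings F U :=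
  sum_card_inner_le F 𝒯 h𝒯 G hG U

/-- The number of pending components with late vertices in `A`. -/
theorem card_pending_meets_le (F : Finset (Sym2 V)) {k : ℕ} {A : Finset V}
    (hA : A ∈ I.comps (I.state ε k)) :
    ((I.pending ε F k).filter fun T => I.Meets ε T A).card ≤ crossings F A := by
  refine le_trans ?_ (crossings_inner_sum_le F ((I.pending ε F k).filter fun T => I.Meets ε T A)
    ((Finset.filter_subset _ _).trans (Finset.filter_subset _ _)) (inner F)
    (fun _ _ => subset_rfl) A)
  rw [Finset.card_eq_sum_ones]
  refine Finset.sum_le_sum fun T hT => ?_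
  obtain ⟨hT, v, hv, hvA⟩ := Finset.mem_filter.1 hT
  obtain ⟨hT, hk, -⟩ := Finset.mem_filter.1 hT
  exact crossings_pos_of_not_finished hT hk hA hvA (late_subset T hv)

/-! ### Clean components -/

variable (I ε)

/-- The demand pairs with two late vertices in `T` of which exactly one is in `A`. -/
def lateSep (T A : Finset V) : Finset (Sym2 V) :=
  I.demands.filter fun d => ∃ a ∈ I.late ε T, ∃ b ∈ I.late ε T, d = s(a, b) ∧ a ∈ A ∧ b ∉ A

variable {I ε}

/-- The unfinished `T` already uses the only edge of `F` crossing `A`. A separated demand pair in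
another component of `(V, F)` would need a second one, so all separated pairs lie in `T`. A late
vertex in `A` then makes their endpoints late. Thus the demands separated by a clean set depend only
on the late vertices in it. -/
theorem sep_eq_lateSep {F : Finset (Sym2 V)} (hF : I.IsSolution F) {k : ℕ} {T A : Finset V}
    (hT : T ∈ I.pending ε F k) (hA : A ∈ I.lateComps ε k T) (hc : I.Clean ε F k A) :
    I.sep A = I.lateSep ε T A := by
  obtain ⟨hTF, hk, -⟩ := Finset.mem_filter.1 hT
  have hAc := mem_comps_of_mem_lateComps hA
  obtain ⟨-, v, hv, hvA⟩ := Finset.mem_filter.1 hA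
  have key : ∀ a b, s(a, b) ∈ I.demands → a ∈ A → b ∉ A → a ∈ I.late ε T ∧ b ∈ I.late ε T := by
    intro a b hab ha hb
    have hlab := hF.2 a b hab
    have haT : a ∈ T := by
      by_contra haT
      have hne : T ≠ component F a := fun h => haT (h ▸ self_mem_component F a)
      have h1 := crossings_inner_sum_le F {T, component F a}
        (Finset.insert_subset hTF (Finset.singleton_subset_iff.2 (component_mem_components F a)))
        (inner F) (fun _ _ => subset_rfl) A
      rw [Finset.sum_pair hne, hc.2] at h1
      have h2 := crossings_pos_of_not_finished hTF hk hAc hvA (late_subset T hv)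
      have h3 := (linked_inner (component_mem_components F a) (self_mem_component F a)
        hlab).crossings_pos ha hb
      omega
    have hbT : b ∈ T := (mem_iff_mem_of_linked hTF hlab).1 haT
    rw [eq_comp_of_mem hAc ha] at hvA hb
    have hal := mem_late_of_separates hv hvA hab hb haT
    exact ⟨hal, mem_late_of_demand hab hbT hal⟩
  ext d
  simp only [mem_sep, lateSep, Finset.mem_filter]
  refine and_congr_right fun hd => ⟨fun hs => ?_, ?_⟩
  · induction d with
    | _ a b =>
      rcases separates_mk.1 hs with h | h
      · obtain ⟨h1, h2⟩ := key a b hd h.1 h.2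
        exact ⟨a, h1, b, h2, rfl, h⟩
      · obtain ⟨h1, h2⟩ := key b a (by rwa [Sym2.eq_swap]) h.2 h.1
        exact ⟨b, h1, a, h2, Sym2.eq_swap, h.2, h.1⟩
  · rintro ⟨a, -, b, -, rfl, h⟩
    exact separates_mk.2 (Or.inl h)

theorem lateSep_congr {T A A' : Finset V} (h : ∀ v ∈ I.late ε T, v ∈ A ↔ v ∈ A') :
    I.lateSep ε T A = I.lateSep ε T A' := by
  refine Finset.filter_congr fun d _ => ?_
  constructor
  · rintro ⟨a, ha, b, hb, h1, h2, h3⟩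
    exact ⟨a, ha, b, hb, h1, (h a ha).1 h2, fun h4 => h3 ((h b hb).2 h4)⟩
  · rintro ⟨a, ha, b, hb, h1, h2, h3⟩
    exact ⟨a, ha, b, hb, h1, (h a ha).2 h2, fun h4 => h3 ((h b hb).1 h4)⟩

theorem lateSep_compl {T A B : Finset V} (h : ∀ v ∈ I.late ε T, v ∈ A ↔ v ∉ B) :
    I.lateSep ε T A = I.lateSep ε T B := by
  refine Finset.filter_congr fun d _ => ?_
  constructor
  · rintro ⟨a, ha, b, hb, h1, h2, h3⟩
    exact ⟨b, hb, a, ha, h1.trans Sym2.eq_swap, by_contra fun h4 => h3 ((h b hb).2 h4),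
      (h a ha).1 h2⟩
  · rintro ⟨a, ha, b, hb, h1, h2, h3⟩
    exact ⟨b, hb, a, ha, h1.trans Sym2.eq_swap, (h b hb).2 h3, fun h4 => (h a ha).1 h4 h2⟩

variable (I ε)

/-- The late vertices of the pending component `T` lie in exactly two active components in
phase `k`, and both are clean. -/
structure CleanPair (F : Finset (Sym2 V)) (k : ℕ) (T A B : Finset V) : Prop where
  pending : T ∈ I.pending ε F k
  ne : A ≠ B
  lateComps : I.lateComps ε k T = {A, B}
  left : I.Clean ε F k A
  right : I.Clean ε F k B

variable {I ε}

namespace CleanPair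

variable {F : Finset (Sym2 V)} {k : ℕ} {T A B : Finset V}

theorem symm (h : I.CleanPair ε F k T A B) : I.CleanPair ε F k T B A :=
  ⟨h.pending, h.ne.symm, h.lateComps.trans (Finset.pair_comm A B), h.right, h.left⟩

theorem left_mem (h : I.CleanPair ε F k T A B) : A ∈ I.lateComps ε k T := by
  rw [h.lateComps]; exact Finset.mem_insert_self _ _

theorem right_mem (h : I.CleanPair ε F k T A B) : B ∈ I.lateComps ε k T := h.symm.left_mem

theorem disjoint (h : I.CleanPair ε F k T A B) : Disjoint A B :=
  disjoint_of_mem_components (mem_comps_of_mem_lateComps h.left_mem)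
    (mem_comps_of_mem_lateComps h.right_mem) h.ne

theorem mem_iff (h : I.CleanPair ε F k T A B) {v : V} (hv : v ∈ I.late ε T) : v ∈ A ↔ v ∉ B := by
  refine ⟨fun hA hB => Finset.disjoint_left.1 h.disjoint hA hB, fun hB => ?_⟩
  have h1 := comp_mem_lateComps (Finset.mem_filter.1 h.pending).2.1 hv
  have h2 := I.self_mem_comp ε k v
  rw [h.lateComps, Finset.mem_insert, Finset.mem_singleton] at h1
  rcases h1 with h1 | h1
  · rwa [← h1]
  · exact absurd (h1 ▸ h2) hB

theorem sep_left (hF : I.IsSolution F) (h : I.CleanPair ε F k T A B) :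
    I.sep A = I.lateSep ε T A := sep_eq_lateSep hF h.pending h.left_mem h.left

/-- The two sets partition the late vertices of `T`, and complementary sets separate the same pairs.
-/
theorem sep_eq (hF : I.IsSolution F) (h : I.CleanPair ε F k T A B) : I.sep A = I.sep B := by
  rw [h.sep_left hF, h.symm.sep_left hF, lateSep_compl fun v hv => h.mem_iff hv]

theorem sep_nonempty (h : I.CleanPair ε F k T A B) : (I.sep A).Nonempty :=
  (mem_demandActive_iff (demandActive_subset _ h.left.1)).1 h.left.1

theorem isAutarkicPair (hε : 0 < ε) (hF : I.IsSolution F) (h : I.CleanPair ε F k T A B) :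
    I.IsAutarkicPair ε {A, B} := by
  have hA := (Finset.mem_filter.1 h.left_mem).1
  have hB := (Finset.mem_filter.1 h.right_mem).1
  have hk := I.lt_horizon_of_mem_active hε hF hA
  refine ⟨A, B, rfl, I.mem_support_of_mem_active hε hF hA, I.mem_support_of_mem_active hε hF hB,
    h.disjoint, ⟨(I.state ε k).time, I.time_nonneg hε hk.le, ?_⟩, h.sep_eq hF, h.sep_nonempty⟩
  rw [I.activeAt_eq hε (I.inPhase_time hε k hk.le)]
  exact ⟨hA, hB⟩

end CleanPair

/-- A pending component whose late vertices are in one active component has no clean one. -/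
theorem not_clean_of_card_eq_one {F : Finset (Sym2 V)} (hF : I.IsSolution F) {k : ℕ}
    {T A : Finset V} (hT : T ∈ I.pending ε F k) (hA : I.lateComps ε k T = {A}) :
    ¬ I.Clean ε F k A := by
  intro hc
  have hmem : A ∈ I.lateComps ε k T := by simp [hA]
  obtain ⟨d, hd⟩ := (mem_demandActive_iff (demandActive_subset _ hc.1)).1 hc.1
  rw [sep_eq_lateSep hF hT hmem hc] at hd
  obtain ⟨-, a, -, b, hb, -, -, hbA⟩ := Finset.mem_filter.1 hd
  have h1 := comp_mem_lateComps (Finset.mem_filter.1 hT).2.1 hb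
  rw [hA, Finset.mem_singleton] at h1
  exact hbA (h1 ▸ I.self_mem_comp ε k b)

/-! ### Comparing two phases -/

section Refine

variable {j k : ℕ} (hjk : j ≤ k) {T : Finset V} (hT : T.Nonempty) (hk : ¬ I.Finished ε k T)

include hjk hT hk

theorem exists_superset_lateComps {A : Finset V} (hA : A ∈ I.lateComps ε j T) :
    ∃ A' ∈ I.lateComps ε k T, A ⊆ A' := by
  obtain ⟨hA1, v, hv, hvA⟩ := Finset.mem_filter.1 hA
  refine ⟨I.comp ε k v, comp_mem_lateComps hk hv, ?_⟩
  rw [eq_comp_of_mem (active_subset _ hA1) hvA]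
  exact I.comp_mono ε hjk v

theorem card_filter_subset_pos {A' : Finset V} (hA' : A' ∈ I.lateComps ε k T) :
    1 ≤ ((I.lateComps ε j T).filter (· ⊆ A')).card := by
  obtain ⟨hA1, v, hv, hvA⟩ := Finset.mem_filter.1 hA'
  refine Finset.card_pos.2 ⟨I.comp ε j v, Finset.mem_filter.2
    ⟨comp_mem_lateComps (fun h => hk (h.mono hjk hT)) hv, ?_⟩⟩
  rw [eq_comp_of_mem (active_subset _ hA1) hvA]
  exact I.comp_mono ε hjk v

theorem sum_card_filter_subset :
    ∑ A' ∈ I.lateComps ε k T, ((I.lateComps ε j T).filter (· ⊆ A')).card =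
      (I.lateComps ε j T).card := by
  rw [sum_card_filter_comm (I.lateComps ε k T) (I.lateComps ε j T) fun A' A => A ⊆ A',
    Finset.card_eq_sum_ones]
  refine Finset.sum_congr rfl fun A hA => Finset.card_eq_one.2 ?_
  obtain ⟨A', hA', hsub⟩ := exists_superset_lateComps hjk hT hk hA
  obtain ⟨-, v, -, hvA⟩ := Finset.mem_filter.1 hA
  refine ⟨A', Finset.ext fun B => ?_⟩
  simp only [Finset.mem_filter, Finset.mem_singleton]
  refine ⟨fun ⟨h1, h2⟩ => ?_, fun h => h ▸ ⟨hA', hsub⟩⟩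
  exact eq_of_mem_components (mem_comps_of_mem_lateComps h1) (mem_comps_of_mem_lateComps hA')
    (h2 hvA) (hsub hvA)

/-- If `A'` has absorbed no late component other than `A`, both contain the same late vertices. -/
theorem lateSep_eq_of_card_eq_one {A A' : Finset V} (hA : A ∈ I.lateComps ε j T)
    (hA' : A' ∈ I.lateComps ε k T) (hsub : A ⊆ A')
    (h1 : ((I.lateComps ε j T).filter (· ⊆ A')).card = 1) :
    I.lateSep ε T A = I.lateSep ε T A' := by
  refine lateSep_congr fun v hv => ⟨fun h => hsub h, fun h => ?_⟩
  have hmem : I.comp ε j v ∈ (I.lateComps ε j T).filter (· ⊆ A') := by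
    refine Finset.mem_filter.2 ⟨comp_mem_lateComps (fun h => hk (h.mono hjk hT)) hv, ?_⟩
    rw [eq_comp_of_mem (mem_comps_of_mem_lateComps hA') h]
    exact I.comp_mono ε hjk v
  have := Finset.card_le_one.1 h1.le _ hmem _ (Finset.mem_filter.2 ⟨hA, hsub⟩)
  rw [← this]
  exact I.self_mem_comp ε j v

end Refine

/-- If all late components are clean and there are two of them, then they separate the same
demand pairs as the clean pair of another phase; if there are three, one of them does. -/
theorem CleanPair.le_card_covered {F : Finset (Sym2 V)} (hF : I.IsSolution F) {k₀ : ℕ}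
    {T A₀ B₀ : Finset V} (h : I.CleanPair ε F k₀ T A₀ B₀) {k : ℕ} (hT : T ∈ I.pending ε F k)
    (hclean : ∀ A ∈ I.lateComps ε k T, I.Clean ε F k A) :
    4 - (I.lateComps ε k T).card ≤ ((I.lateComps ε k T).filter
        fun A => I.Clean ε F k A ∧ I.sep A = I.sep A₀).card ∨ (I.lateComps ε k T).card < 2 := by
  obtain ⟨hTF, hk, -⟩ := Finset.mem_filter.1 hT
  have hk₀ := (Finset.mem_filter.1 h.pending).2.1
  have hTn := nonempty_of_mem_components hTF
  have hsep : ∀ A ∈ I.lateComps ε k T, ∀ X ∈ I.lateComps ε k₀ T,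
      I.lateSep ε T A = I.lateSep ε T X → I.Clean ε F k A ∧ I.sep A = I.sep A₀ := by
    intro A hA X hX heq
    refine ⟨hclean A hA, ?_⟩
    rw [sep_eq_lateSep hF hT hA (hclean A hA), heq]
    rw [h.lateComps, Finset.mem_insert, Finset.mem_singleton] at hX
    rcases hX with rfl | rfl
    · rw [h.sep_left hF]
    · rw [h.sep_eq hF, h.symm.sep_left hF]
  have hcard₀ : (I.lateComps ε k₀ T).card = 2 := by rw [h.lateComps, Finset.card_pair h.ne]
  rcases le_total k k₀ with hkk | hkk
  · have hs := sum_card_filter_subset hkk hTn hk₀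
    rw [h.lateComps, Finset.sum_pair h.ne] at hs
    have hA1 := card_filter_subset_pos hkk hTn hk₀ h.left_mem
    have hB1 := card_filter_subset_pos hkk hTn hk₀ h.right_mem
    have hone : ∀ X ∈ I.lateComps ε k₀ T, ((I.lateComps ε k T).filter (· ⊆ X)).card = 1 →
        ∀ A ∈ I.lateComps ε k T, A ⊆ X → A ∈ (I.lateComps ε k T).filter
          fun A => I.Clean ε F k A ∧ I.sep A = I.sep A₀ := fun X hX h1 A hA hAX =>
      Finset.mem_filter.2 ⟨hA, hsep A hA X hX
        (lateSep_eq_of_card_eq_one hkk hTn hk₀ hA hX hAX h1)⟩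
    have hex : ∀ X ∈ I.lateComps ε k₀ T, ((I.lateComps ε k T).filter (· ⊆ X)).card = 1 →
        1 ≤ ((I.lateComps ε k T).filter
          fun A => I.Clean ε F k A ∧ I.sep A = I.sep A₀).card := by
      intro X hX h1
      obtain ⟨A, hA⟩ := Finset.card_pos.1 (h1 ▸ one_pos)
      obtain ⟨hA, hAX⟩ := Finset.mem_filter.1 hA
      exact Finset.card_pos.2 ⟨A, hone X hX h1 A hA hAX⟩
    -- The earlier late components are distributed over `A₀` and `B₀`, each receiving at least one.
    -- With two of them each receives exactly one; with three, one side receives exactly one; from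
    -- four on, the truncated subtraction asks for nothing.
    left
    by_cases h2 : (I.lateComps ε k T).card = 2
    · refine le_trans (by omega) (Finset.card_le_card (s := I.lateComps ε k T) fun A hA => ?_)
      obtain ⟨X, hX, hAX⟩ := exists_superset_lateComps hkk hTn hk₀ hA
      refine hone X hX ?_ A hA hAX
      rw [h.lateComps, Finset.mem_insert, Finset.mem_singleton] at hX
      rcases hX with rfl | rfl <;> omega
    by_cases h3 : (I.lateComps ε k T).card = 3
    · rcases Nat.eq_or_lt_of_le hA1 with h4 | h4
      · have := hex A₀ h.left_mem h4.symm
        omega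
      · have := hex B₀ h.right_mem (by omega)
        omega
    omega
  -- In a later phase the late components are unions of the two old ones as far as late vertices go.
  -- If two remain, each comes from exactly one.
  · have hs := sum_card_filter_subset hkk hTn hk
    have hpos := fun A (hA : A ∈ I.lateComps ε k T) => card_filter_subset_pos hkk hTn hk hA
    have hle : (I.lateComps ε k T).card ≤ 2 := by
      rw [← hcard₀, ← hs, Finset.card_eq_sum_ones]
      exact Finset.sum_le_sum hpos
    by_cases h2 : (I.lateComps ε k T).card = 2
    · left
      refine le_trans (by omega) (Finset.card_le_card (s := I.lateComps ε k T) fun A hA => ?_)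
      have h1 : ((I.lateComps ε k₀ T).filter (· ⊆ A)).card = 1 := by
        have hsum : ∑ A ∈ I.lateComps ε k T, 1 =
            ∑ A ∈ I.lateComps ε k T, ((I.lateComps ε k₀ T).filter (· ⊆ A)).card := by
          rw [hs, hcard₀, ← Finset.card_eq_sum_ones, h2]
        exact ((Finset.sum_eq_sum_iff_of_le hpos).1 hsum A hA).symm
      obtain ⟨X, hX⟩ := Finset.card_pos.1 (h1 ▸ one_pos)
      obtain ⟨hX, hXA⟩ := Finset.mem_filter.1 hX
      exact Finset.mem_filter.2 ⟨hA, hsep A hA X hX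
        (lateSep_eq_of_card_eq_one hkk hTn hk hX hA hXA h1).symm⟩
    · right; omega

/-! ### The inequality for one component of the solution -/

theorem one_le_card_lateComps {F : Finset (Sym2 V)} {k : ℕ} {T : Finset V}
    (hT : T ∈ I.pending ε F k) : 1 ≤ (I.lateComps ε k T).card := by
  obtain ⟨-, hk, v, hv⟩ := Finset.mem_filter.1 hT
  exact Finset.card_pos.2 ⟨_, comp_mem_lateComps hk hv⟩

theorem one_le_card_not_clean {F : Finset (Sym2 V)} (hF : I.IsSolution F) {k : ℕ} {T : Finset V}
    (hT : T ∈ I.pending ε F k) (h : (I.lateComps ε k T).card = 1) :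
    1 ≤ ((I.lateComps ε k T).filter fun A => ¬ I.Clean ε F k A).card := by
  obtain ⟨A, hA⟩ := Finset.card_eq_one.1 h
  exact Finset.card_pos.2 ⟨A, Finset.mem_filter.2 ⟨by simp [hA], not_clean_of_card_eq_one hF hT hA⟩⟩

theorem clean_of_card_not_clean {F : Finset (Sym2 V)} {k : ℕ} {T : Finset V}
    (h : ((I.lateComps ε k T).filter fun A => ¬ I.Clean ε F k A).card = 0) :
    ∀ A ∈ I.lateComps ε k T, I.Clean ε F k A := by
  simpa [Finset.filter_eq_empty_iff] using h

/-- Let `n` be the number of late components. For `n = 1` it is not clean and `7 + 13 = 20` is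
tight. For `n = 2` one is not clean, since otherwise they would form a clean pair. For `n ≥ 3`
already `21 ≥ 20`. -/
theorem component_inequality_unpaired {F : Finset (Sym2 V)} (hF : I.IsSolution F) {k : ℕ}
    {T : Finset V} (hT : T ∈ I.pending ε F k) (hno : ¬ ∃ j A B, I.CleanPair ε F j T A B) :
    20 ≤ 7 * (I.lateComps ε k T).card +
      13 * ((I.lateComps ε k T).filter fun A => ¬ I.Clean ε F k A).card := by
  have h1 := one_le_card_lateComps hT
  have h2 := one_le_card_not_clean hF hT
  have h3 : (I.lateComps ε k T).card = 2 →
      ((I.lateComps ε k T).filter fun A => ¬ I.Clean ε F k A).card ≠ 0 := by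
    intro h3 h4
    obtain ⟨A, B, hne, hAB⟩ := Finset.card_eq_two.1 h3
    have h5 := clean_of_card_not_clean h4
    exact hno ⟨k, A, B, hT, hne, hAB, h5 A (by simp [hAB]), h5 B (by simp [hAB])⟩
  omega

/-- The active components that contain exactly one of `a` and `b`. -/
theorem card_split_le {k : ℕ} (a b : V) :
    ((I.active (I.state ε k)).filter fun A => ¬ (a ∈ A ↔ b ∈ A)).card ≤ 2 := by
  refine (Finset.card_le_card (t := {I.comp ε k a, I.comp ε k b}) fun A hA => ?_).trans
    Finset.card_le_two
  obtain ⟨hA, hab⟩ := Finset.mem_filter.1 hA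
  by_cases ha : a ∈ A
  · simp [eq_comp_of_mem (active_subset _ hA) ha]
  · simp [eq_comp_of_mem (active_subset _ hA) (show b ∈ A by tauto)]

theorem card_split_eq_zero {k : ℕ} {a b : V} (h : I.comp ε k a = I.comp ε k b) :
    ((I.active (I.state ε k)).filter fun A => ¬ (a ∈ A ↔ b ∈ A)).card = 0 := by
  refine Finset.card_eq_zero.2 (Finset.filter_eq_empty_iff.2 fun A hA => ?_)
  rw [not_not]
  constructor
  · intro ha
    rw [eq_comp_of_mem (active_subset _ hA) ha, h]; exact I.self_mem_comp ε k b
  · intro hb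
    rw [eq_comp_of_mem (active_subset _ hA) hb, ← h]; exact I.self_mem_comp ε k a

/-- A single late component is not clean and splits nothing: `20 = 7 + 13`. Otherwise at most 26 is
needed. If all are clean, two give `14 + 12`, three give at least `21 + 6` and four give 28; if one
is not clean, two already give `14 + 13`. -/
theorem component_inequality_paired {F : Finset (Sym2 V)} (hF : I.IsSolution F) {k₀ : ℕ}
    {T A₀ B₀ : Finset V} (h : I.CleanPair ε F k₀ T A₀ B₀) {k : ℕ} (hT : T ∈ I.pending ε F k)
    {a b : V} (ha : a ∈ I.late ε T) (hb : b ∈ I.late ε T) :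
    20 + 3 * ((I.active (I.state ε k)).filter fun A => ¬ (a ∈ A ↔ b ∈ A)).card ≤
      7 * (I.lateComps ε k T).card +
        6 * ((I.lateComps ε k T).filter fun A => I.Clean ε F k A ∧ I.sep A = I.sep A₀).card +
        13 * ((I.lateComps ε k T).filter fun A => ¬ I.Clean ε F k A).card := by
  have h1 := one_le_card_lateComps hT
  have h2 := one_le_card_not_clean hF hT
  have h3 := fun h0 => h.le_card_covered hF hT (clean_of_card_not_clean h0)
  have h4 := card_split_le (I := I) (ε := ε) (k := k) a b
  have h5 : (I.lateComps ε k T).card = 1 →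
      ((I.active (I.state ε k)).filter fun A => ¬ (a ∈ A ↔ b ∈ A)).card = 0 := by
    intro h6
    have hk := (Finset.mem_filter.1 hT).2.1
    exact card_split_eq_zero (Finset.card_le_one.1 h6.le _ (comp_mem_lateComps hk ha) _
      (comp_mem_lateComps hk hb))
  omega

end

section

variable {I : SteinerForestInstance V} {ε : ℝ}

/-! ### The inequality for one phase -/

/-- A clean set has no surplus, and `x`, `q`, `m` are at most 1, so the two implications pay for it.
Otherwise everything is charged to surplus. The constant `51 = 3 * 17` is needed for a demand-active
set with two crossings: if `x = q = m = 2`, the surplus of 1 must cover up to 49. -/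
theorem set_inequality {F : Finset (Sym2 V)} (hF : I.IsSolution F) {k : ℕ} {A : Finset V}
    {x q m u : ℕ} (hx : x ≤ crossings F A) (hq : q ≤ crossings F A) (hm : m ≤ crossings F A)
    (hxm : I.Clean ε F k A → 1 ≤ x → 1 ≤ m) (hqu : I.Clean ε F k A → 1 ≤ q → 1 ≤ u) :
    10 * x + 3 * q + 7 * (m - 1) + 13 * (if I.Clean ε F k A then 0 else m) ≤
      10 * (if 1 ≤ m then 1 else 0) + 3 * u + 51 * I.surplus ε F k A := by
  by_cases hD : A ∈ I.demandActive (I.state ε k)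
  · have hpos := crossings_pos_of_demandActive hF hD
    simp only [Clean, surplus, hD, true_and, if_true] at *
    split_ifs <;> omega
  · simp only [Clean, surplus, hD, false_and, if_false] at *
    split_ifs <;> omega

/-- The data of the proof: connectors of the late vertices of all components of `F`, and connectors
`Q T` of two late vertices `a T` and `b T` for the components `T ∈ 𝒲`, those with a clean pair. -/
structure ConnectorData (I : SteinerForestInstance V) (ε : ℝ) (F : Finset (Sym2 V))
    (𝒲 : Finset (Finset V)) (k₀ : Finset V → ℕ) (A₀ B₀ : Finset V → Finset V)
    (a b : Finset V → V) (R Q : Finset V → Finset (Sym2 V)) : Prop where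
  subset : 𝒲 ⊆ components F
  pair : ∀ T ∈ 𝒲, I.CleanPair ε F (k₀ T) T (A₀ T) (B₀ T)
  no_pair : ∀ T ∈ components F, T ∉ 𝒲 → ¬ ∃ j A B, I.CleanPair ε F j T A B
  left_mem : ∀ T ∈ 𝒲, a T ∈ I.late ε T
  right_mem : ∀ T ∈ 𝒲, b T ∈ I.late ε T
  tree_subset : ∀ T ∈ components F, R T ⊆ inner F T
  tree_minimal : ∀ T ∈ components F, ∀ U, crossings (R T) U = 1 → ∃ v ∈ I.late ε T, v ∈ U
  path_subset : ∀ T ∈ 𝒲, Q T ⊆ inner F T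
  path_minimal : ∀ T ∈ 𝒲, ∀ U, crossings (Q T) U = 1 → ¬ (a T ∈ U ↔ b T ∈ U)

theorem not_finished_of_crossings {F G : Finset (Sym2 V)} {T A : Finset V} {k : ℕ}
    (hG : G ⊆ inner F T) (hA : A ∈ I.comps (I.state ε k)) (h : crossings G A = 1) :
    ¬ I.Finished ε k T := by
  intro hk
  have := crossings_mono hG A
  have := crossings_eq_zero_of_finished (F := F) hk hA
  omega

/-- Double counting of incidences between active sets and pending components. Summing
`set_inequality` over the sets and the component inequalities over the pending `T`, the splits `u`,
the repeated meetings `m - 1` and the meetings with sets that are not clean cancel. The remaining `7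
+ 10` copies of the number of late active sets give 17. -/
theorem ConnectorData.phase_inequality {F : Finset (Sym2 V)} (hF : I.IsSolution F)
    {𝒲 : Finset (Finset V)} {k₀ : Finset V → ℕ} {A₀ B₀ : Finset V → Finset V}
    {a b : Finset V → V} {R Q : Finset V → Finset (Sym2 V)}
    (h : ConnectorData I ε F 𝒲 k₀ A₀ B₀ a b R Q) (k : ℕ) :
    20 * (I.pending ε F k).card +
        10 * ∑ A ∈ I.active (I.state ε k), ∑ T ∈ components F, crossings (R T) A +
        3 * ∑ A ∈ I.active (I.state ε k), ∑ T ∈ 𝒲, crossings (Q T) A ≤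
      17 * (I.lateActive ε F k).card +
        6 * ((I.active (I.state ε k)).filter fun A => ∃ T ∈ 𝒲, I.sep A = I.sep (A₀ T)).card +
        51 * ∑ A ∈ I.active (I.state ε k), I.surplus ε F k A := by
  set 𝒜 := I.active (I.state ε k)
  set 𝒯 := I.pending ε F k
  have h𝒯F : 𝒯 ⊆ components F := Finset.filter_subset _ _
  let 𝒲' := 𝒯.filter (· ∈ 𝒲)
  let m : Finset V → ℕ := fun A => (𝒯.filter fun T => I.Meets ε T A).card
  let u : Finset V → ℕ := fun A => (𝒲'.filter fun T => ¬ (a T ∈ A ↔ b T ∈ A)).card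
  -- one set at a time
  have hset : ∀ A ∈ 𝒜, 10 * ∑ T ∈ components F, crossings (R T) A +
      3 * ∑ T ∈ 𝒲, crossings (Q T) A + 7 * (m A - 1) +
      13 * (if I.Clean ε F k A then 0 else m A) ≤
      10 * (if 1 ≤ m A then 1 else 0) + 3 * u A + 51 * I.surplus ε F k A := by
    intro A hA
    have hAc := active_subset _ hA
    have hx := crossings_inner_sum_le F _ subset_rfl R h.tree_subset A
    have hq := crossings_inner_sum_le F _ h.subset Q h.path_subset A
    refine set_inequality hF hx hq (card_pending_meets_le F hAc) (fun hc h1 => ?_)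
      (fun hc h1 => ?_)
    · obtain ⟨T, hT, hne⟩ := Finset.exists_ne_zero_of_sum_ne_zero (Nat.pos_iff_ne_zero.1 h1)
      have h2 := Finset.single_le_sum (f := fun T => crossings (R T) A)
        (fun _ _ => Nat.zero_le _) hT
      have h3 : crossings (R T) A = 1 := by have := hc.2; omega
      have hk := not_finished_of_crossings (h.tree_subset T hT) hAc h3
      obtain ⟨v, hv, hvA⟩ := h.tree_minimal T hT A h3
      exact Finset.card_pos.2 ⟨T, Finset.mem_filter.2
        ⟨Finset.mem_filter.2 ⟨hT, hk, v, hv⟩, v, hv, hvA⟩⟩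
    · obtain ⟨T, hT, hne⟩ := Finset.exists_ne_zero_of_sum_ne_zero (Nat.pos_iff_ne_zero.1 h1)
      have h2 := Finset.single_le_sum (f := fun T => crossings (Q T) A)
        (fun _ _ => Nat.zero_le _) hT
      have h3 : crossings (Q T) A = 1 := by have := hc.2; omega
      have hk := not_finished_of_crossings (h.path_subset T hT) hAc h3
      exact Finset.card_pos.2 ⟨T, Finset.mem_filter.2 ⟨Finset.mem_filter.2
        ⟨Finset.mem_filter.2 ⟨h.subset hT, hk, _, h.left_mem T hT⟩, hT⟩,
        h.path_minimal T hT A h3⟩⟩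
  -- one component of the solution at a time
  have hcomp : ∀ T ∈ 𝒯, 20 + 3 * (if T ∈ 𝒲 then
      (𝒜.filter fun A => ¬ (a T ∈ A ↔ b T ∈ A)).card else 0) ≤
      7 * (I.lateComps ε k T).card + 6 * (if T ∈ 𝒲 then
        ((I.lateComps ε k T).filter fun A => I.Clean ε F k A ∧ I.sep A = I.sep (A₀ T)).card
        else 0) +
      13 * ((I.lateComps ε k T).filter fun A => ¬ I.Clean ε F k A).card := by
    intro T hT
    by_cases hTP : T ∈ 𝒲
    · simp only [if_pos hTP]
      exact component_inequality_paired hF (h.pair T hTP) hT (h.left_mem T hTP)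
        (h.right_mem T hTP)
    · have := component_inequality_unpaired hF hT (h.no_pair T (h𝒯F hT) hTP)
      simp only [if_neg hTP]
      omega
  have hset := Finset.sum_le_sum hset
  have hcomp := Finset.sum_le_sum hcomp
  simp only [Finset.sum_add_distrib, ← Finset.mul_sum, ← Finset.sum_filter, Finset.sum_const,
    smul_eq_mul] at hset hcomp
  have h1 : ∑ A ∈ 𝒜, u A = ∑ T ∈ 𝒲', (𝒜.filter fun A => ¬ (a T ∈ A ↔ b T ∈ A)).card :=
    sum_card_filter_comm 𝒜 𝒲' fun A T => ¬ (a T ∈ A ↔ b T ∈ A)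
  have h2 : ∑ A ∈ 𝒜, m A = ∑ T ∈ 𝒯, (I.lateComps ε k T).card :=
    sum_card_filter_comm 𝒜 𝒯 fun A T => I.Meets ε T A
  have h3 : ∑ T ∈ 𝒯, ((I.lateComps ε k T).filter fun A => ¬ I.Clean ε F k A).card =
      ∑ A ∈ 𝒜, if I.Clean ε F k A then 0 else m A := by
    simp only [lateComps, Finset.filter_filter]
    rw [sum_card_filter_comm 𝒯 𝒜 fun T A => I.Meets ε T A ∧ ¬ I.Clean ε F k A]
    refine Finset.sum_congr rfl fun A _ => ?_
    split_ifs with hc <;> simp [hc, m]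
  have h4 : (I.lateActive ε F k).card = (𝒜.filter fun A => 1 ≤ m A).card := by
    congr 1
    refine Finset.filter_congr fun A _ => ?_
    rw [Nat.one_le_iff_ne_zero, ← Nat.pos_iff_ne_zero, Finset.card_pos]
    exact ⟨fun ⟨T, hT, hA⟩ => ⟨T, Finset.mem_filter.2 ⟨hT, hA⟩⟩,
      fun ⟨T, hT⟩ => ⟨T, Finset.mem_filter.1 hT⟩⟩
  have h5 : ∑ A ∈ 𝒜, m A = (𝒜.filter fun A => 1 ≤ m A).card + ∑ A ∈ 𝒜, (m A - 1) := by
    rw [Finset.card_filter, ← Finset.sum_add_distrib]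
    exact Finset.sum_congr rfl fun A _ => by split_ifs <;> omega
  have h6 : ∑ T ∈ 𝒲', ((I.lateComps ε k T).filter fun A =>
      I.Clean ε F k A ∧ I.sep A = I.sep (A₀ T)).card ≤
      (𝒜.filter fun A => ∃ T ∈ 𝒲, I.sep A = I.sep (A₀ T)).card := by
    simp only [lateComps, Finset.filter_filter]
    rw [sum_card_filter_comm 𝒲' 𝒜 fun T A =>
      I.Meets ε T A ∧ I.Clean ε F k A ∧ I.sep A = I.sep (A₀ T), Finset.card_filter]
    refine Finset.sum_le_sum fun A hA => ?_
    rcases Finset.eq_empty_or_nonempty (𝒲'.filter fun T =>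
      I.Meets ε T A ∧ I.Clean ε F k A ∧ I.sep A = I.sep (A₀ T)) with h0 | ⟨T, hT⟩
    · rw [h0]; simp
    · obtain ⟨hT, -, hc, hs⟩ := Finset.mem_filter.1 hT
      -- A clean set is crossed by one edge of `F`, so it meets at most one pending component and is
      -- not counted twice.
      rw [if_pos ⟨T, (Finset.mem_filter.1 hT).2, hs⟩, ← hc.2]
      refine (Finset.card_le_card fun T' hT' => ?_).trans
        (card_pending_meets_le F (active_subset _ hA))
      obtain ⟨hT', hm, -⟩ := Finset.mem_filter.1 hT'
      exact Finset.mem_filter.2 ⟨(Finset.mem_filter.1 hT').1, hm⟩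
  have h7 : 𝒯.filter (· ∈ 𝒲) = 𝒲' := rfl
  rw [h7] at hcomp
  omega

/-! ### Costs of collections -/

theorem totalCost_nonneg {F : Finset (Sym2 V)} (hF : F ⊆ I.edges) : 0 ≤ I.totalCost F :=
  Finset.sum_nonneg fun e he => I.cost_nonneg e (by simpa [edges] using hF he)

theorem steinerCost_le {S : Finset V} {F : Finset (Sym2 V)} (hF : F ⊆ I.edges)
    (h : ∀ u ∈ S, ∀ v ∈ S, Linked F u v) : I.steinerCost S ≤ I.totalCost F :=
  csInf_le ⟨0, by rintro _ ⟨F', hF', -, rfl⟩; exact totalCost_nonneg hF'⟩ ⟨F, hF, h, rfl⟩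

theorem steinerCost_nonneg (S : Finset V) : 0 ≤ I.steinerCost S :=
  Real.sInf_nonneg (by rintro _ ⟨F', hF', -, rfl⟩; exact totalCost_nonneg hF')

/-- Connectors inside different components of `(V, F)` are edge-disjoint, so together they use the
slack of `F` at most once. -/
theorem sum_totalCost_le (hε : 0 < ε) {F : Finset (Sym2 V)} (hF : F ⊆ I.edges)
    {𝒯 : Finset (Finset V)} (h𝒯 : 𝒯 ⊆ components F) {G : Finset V → Finset (Sym2 V)}
    (hG : ∀ T ∈ 𝒯, G T ⊆ inner F T) :
    ∑ T ∈ 𝒯, I.totalCost (G T) ≤ ∑ e ∈ F, I.slack ε e +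
      ∑ j ∈ Finset.range (I.horizon ε), I.duration ε j *
        ((∑ A ∈ I.active (I.state ε j), ∑ T ∈ 𝒯, crossings (G T) A : ℕ) : ℝ) := by
  rw [Finset.sum_congr rfl fun T hT =>
    I.totalCost_eq hε (((hG T hT).trans (inner_subset F T)).trans hF), Finset.sum_add_distrib]
  refine add_le_add (sum_inner_le F 𝒯 h𝒯 G hG _ fun e he => I.slack_nonneg hε (hF he)) (le_of_eq ?_)
  rw [Finset.sum_comm]
  refine Finset.sum_congr rfl fun j _ => ?_
  rw [← Finset.mul_sum, Finset.sum_comm]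
  push_cast
  rfl

theorem coverage_eq (hε : 0 < ε) {F : Finset (Sym2 V)} (hF : I.IsSolution F)
    (𝒬 : Finset (Finset (Finset V))) : I.coverage ε 𝒬 =
      ∑ j ∈ Finset.range (I.horizon ε), I.duration ε j *
        (((I.active (I.state ε j)).filter fun A => ∃ P ∈ 𝒬, ∃ B ∈ P, I.sep B = I.sep A).card :
          ℝ) := by
  have : I.coverage ε 𝒬 = ∑ U, I.dual ε U * if I.Covers ε 𝒬 U then 1 else 0 := by
    simp [coverage, Finset.sum_filter]
  rw [this, I.sum_dual hε]
  refine Finset.sum_congr rfl fun j _ => ?_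
  rw [← Finset.sum_filter, Finset.sum_const, nsmul_eq_mul, mul_one]
  congr 3
  refine Finset.filter_congr fun A hA => ?_
  exact and_iff_right (I.mem_support_of_mem_active hε hF hA)

/-- Only an inequality, since different components may have the same image, for instance an empty
set of late vertices. -/
theorem collectionCost_image_le (𝒯 : Finset (Finset V)) (f : Finset V → Finset V) :
    I.collectionCost (𝒯.image f) ≤ ∑ T ∈ 𝒯, I.steinerCost (f T) := by
  rw [collectionCost]
  exact Finset.sum_image_le_of_nonneg fun S _ => steinerCost_nonneg S

theorem connectorCost_image_le (𝒯 : Finset (Finset V)) (f : Finset V → Finset (Finset V))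
    (rep : Finset (Finset V) → Sym2 (Finset V) → Sym2 V) :
    I.connectorCost rep (𝒯.image f) ≤
      ∑ T ∈ 𝒯, I.steinerCost (I.connectorTerminals rep (f T)) := by
  rw [connectorCost]
  exact Finset.sum_image_le_of_nonneg fun S _ => steinerCost_nonneg _

end

section

variable {I : SteinerForestInstance V} {ε : ℝ}

/-! ### Autarkic pairs and their connectors -/

theorem CleanPair.mem_late_of_mem_tupleSep {F : Finset (Sym2 V)} (hF : I.IsSolution F) {k : ℕ}
    {T A B : Finset V} (h : I.CleanPair ε F k T A B) {d : Sym2 V} (hd : d ∈ I.tupleSep {A, B}) :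
    ∃ a ∈ I.late ε T, ∃ b ∈ I.late ε T, d = s(a, b) := by
  have hd' : d ∈ I.sep A := by
    rw [tupleSep, Finset.mem_biUnion] at hd
    obtain ⟨X, hX, hdX⟩ := hd
    rw [Finset.mem_insert, Finset.mem_singleton] at hX
    rcases hX with rfl | rfl
    · exact hdX
    · rwa [h.sep_eq hF]
  rw [h.sep_left hF] at hd'
  obtain ⟨-, a, ha, b, hb, hab, -⟩ := Finset.mem_filter.1 hd'
  exact ⟨a, ha, b, hb, hab⟩

/-- Demands separated by the clean pair of `T` have their endpoints in `T`, and the components of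
`(V, F)` are disjoint. -/
theorem crossingFree_pairs {F : Finset (Sym2 V)} (hF : I.IsSolution F) {𝒲 : Finset (Finset V)}
    (h𝒲 : 𝒲 ⊆ components F) {k₀ : Finset V → ℕ} {A₀ B₀ : Finset V → Finset V}
    (h : ∀ T ∈ 𝒲, I.CleanPair ε F (k₀ T) T (A₀ T) (B₀ T)) :
    I.CrossingFree (𝒲.image fun T => {A₀ T, B₀ T}) := by
  intro P hP Q hQ hne
  obtain ⟨T, hT, rfl⟩ := Finset.mem_image.1 hP
  obtain ⟨T', hT', rfl⟩ := Finset.mem_image.1 hQ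
  refine Finset.disjoint_left.2 fun d hd hd' => hne ?_
  obtain ⟨a, ha, b, -, rfl⟩ := (h T hT).mem_late_of_mem_tupleSep hF hd
  obtain ⟨a', ha', b', hb', heq⟩ := (h T' hT').mem_late_of_mem_tupleSep hF hd'
  have haT' : a ∈ T' := by
    rcases Sym2.eq_iff.1 heq with ⟨rfl, -⟩ | ⟨rfl, -⟩
    · exact late_subset _ ha'
    · exact late_subset _ hb'
  rw [eq_of_mem_components (h𝒲 hT) (h𝒲 hT') (late_subset _ ha) haT']

theorem connectorTerminals_pair_subset (rep : Finset (Finset V) → Sym2 (Finset V) → Sym2 V)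
    {A B : Finset V} {a b : V} (h : rep {A, B} s(A, B) = s(a, b)) :
    I.connectorTerminals rep {A, B} ⊆ {a, b} := by
  intro v hv
  obtain ⟨-, X, hX, Y, hY, hne, -, hv⟩ := Finset.mem_filter.1 hv
  have hXY : s(X, Y) = s(A, B) := by
    rw [Finset.mem_insert, Finset.mem_singleton] at hX hY
    rcases hX with rfl | rfl <;> rcases hY with rfl | rfl
    · exact absurd rfl hne
    · rfl
    · exact Sym2.eq_swap
    · exact absurd rfl hne
  rw [hXY, h] at hv
  simpa using hv

/-- The collections are fixed before `rep`; only the paths `Q` depend on it. Any representative has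
two late endpoints in `T`, so a minimal connector for it exists inside the solution whichever is
chosen. -/
theorem exists_connectorData [Nonempty V] {F : Finset (Sym2 V)} (hF : I.IsSolution F) {𝒲 : Finset (Finset V)}
    (h𝒲 : 𝒲 ⊆ components F) {k₀ : Finset V → ℕ} {A₀ B₀ : Finset V → Finset V}
    (h : ∀ T ∈ 𝒲, I.CleanPair ε F (k₀ T) T (A₀ T) (B₀ T))
    (hno : ∀ T ∈ components F, T ∉ 𝒲 → ¬ ∃ j A B, I.CleanPair ε F j T A B)
    {rep : Finset (Finset V) → Sym2 (Finset V) → Sym2 V}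
    (hrep : I.IsRepresentative (𝒲.image fun T => {A₀ T, B₀ T}) rep) :
    ∃ (a b : Finset V → V) (R Q : Finset V → Finset (Sym2 V)),
      ConnectorData I ε F 𝒲 k₀ A₀ B₀ a b R Q ∧
      (∀ T ∈ components F, I.steinerCost (I.late ε T) ≤ I.totalCost (R T)) ∧
      ∀ T ∈ 𝒲, I.steinerCost (I.connectorTerminals rep {A₀ T, B₀ T}) ≤ I.totalCost (Q T) := by
  have hR : ∀ T, ∃ R : Finset (Sym2 V), T ∈ components F → R ⊆ inner F T ∧
      (∀ U, crossings R U = 1 → ∃ v ∈ I.late ε T, v ∈ U) ∧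
      I.steinerCost (I.late ε T) ≤ I.totalCost R := by
    intro T
    by_cases hT : T ∈ components F
    · obtain ⟨R, h1, h2, h3⟩ := exists_minimal_connector (inner F T) (I.late ε T)
        fun u hu v hv => linked_inner hT (late_subset T hu)
          (linked_of_mem_components hT (late_subset T hu) (late_subset T hv))
      exact ⟨R, fun _ => ⟨h1, fun U hU => (h3 U hU).1,
        steinerCost_le ((h1.trans (inner_subset F T)).trans hF.1) h2⟩⟩
    · exact ⟨∅, fun h => absurd h hT⟩
  have hQ : ∀ T, ∃ x : V × V × Finset (Sym2 V), T ∈ 𝒲 → x.1 ∈ I.late ε T ∧ x.2.1 ∈ I.late ε T ∧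
      x.2.2 ⊆ inner F T ∧ (∀ U, crossings x.2.2 U = 1 → ¬ (x.1 ∈ U ↔ x.2.1 ∈ U)) ∧
      I.steinerCost (I.connectorTerminals rep {A₀ T, B₀ T}) ≤ I.totalCost x.2.2 := by
    intro T
    by_cases hT : T ∈ 𝒲
    · have hp := h T hT
      have hTF := h𝒲 hT
      have hd := hrep _ (Finset.mem_image_of_mem _ hT) (A₀ T) (by simp) (B₀ T) (by simp) hp.ne
        (by rw [← hp.sep_eq hF, Finset.inter_self]; exact hp.sep_nonempty)
      obtain ⟨a, ha, b, hb, hab⟩ := hp.mem_late_of_mem_tupleSep hF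
        (Finset.mem_biUnion.2 ⟨A₀ T, by simp, (Finset.mem_inter.1 hd).1⟩)
      obtain ⟨Q, h1, h2, h3⟩ := exists_minimal_connector (inner F T) {a, b} fun u hu v hv => by
        have hsub : ({a, b} : Finset V) ⊆ T := by
          intro w hw
          rw [Finset.mem_insert, Finset.mem_singleton] at hw
          rcases hw with rfl | rfl
          · exact late_subset T ha
          · exact late_subset T hb
        exact linked_inner hTF (hsub hu) (linked_of_mem_components hTF (hsub hu) (hsub hv))
      have hsub := connectorTerminals_pair_subset (I := I) rep hab
      refine ⟨⟨a, b, Q⟩, fun _ => ⟨ha, hb, h1, fun U hU hiff => ?_,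
        steinerCost_le ((h1.trans (inner_subset F T)).trans hF.1)
          fun u hu v hv => h2 u (hsub hu) v (hsub hv)⟩⟩
      obtain ⟨⟨u, hu, huU⟩, v, hv, hvU⟩ := h3 U hU
      rw [Finset.mem_insert, Finset.mem_singleton] at hu hv
      rcases hu with rfl | rfl <;> rcases hv with rfl | rfl <;> simp only at hiff <;> tauto
    · exact ⟨⟨Classical.arbitrary V, Classical.arbitrary V, ∅⟩, fun h => absurd h hT⟩
  choose R hR using hR
  choose x hx using hQ
  exact ⟨fun T => (x T).1, fun T => (x T).2.1, R, fun T => (x T).2.2,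
    { subset := h𝒲
      pair := h
      no_pair := hno
      left_mem := fun T hT => (hx T hT).1
      right_mem := fun T hT => (hx T hT).2.1
      tree_subset := fun T hT => (hR T hT).1
      tree_minimal := fun T hT => (hR T hT).2.1
      path_subset := fun T hT => (hx T hT).2.2.1
      path_minimal := fun T hT => (hx T hT).2.2.2.1 },
    fun T hT => (hR T hT).2.2, fun T hT => (hx T hT).2.2.2.2⟩

/-! ### The main inequality -/

theorem ConnectorData.main_inequality (hε : 0 < ε) {F : Finset (Sym2 V)} (hF : I.IsOptimal F)
    {𝒲 : Finset (Finset V)} {k₀ : Finset V → ℕ} {A₀ B₀ : Finset V → Finset V}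
    {a b : Finset V → V} {R Q : Finset V → Finset (Sym2 V)}
    (h : ConnectorData I ε F 𝒲 k₀ A₀ B₀ a b R Q) :
    I.sepValue ε ≤ 10 / 3 * (I.gain ε ((components F).image (I.late ε)) -
        ∑ T ∈ components F, I.totalCost (R T)) +
      (2 * I.coverage ε (𝒲.image fun T => {A₀ T, B₀ T}) - ∑ T ∈ 𝒲, I.totalCost (Q T)) +
      (1 / (2 * ε) + 17) * I.excess ε F := by
  have hR := sum_totalCost_le hε hF.1.1 subset_rfl h.tree_subset
  have hQ := sum_totalCost_le hε hF.1.1 h.subset h.path_subset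
  have hslack : 0 ≤ ∑ e ∈ F, I.slack ε e :=
    Finset.sum_nonneg fun e he => I.slack_nonneg hε (hF.1.1 he)
  have hprem : ∑ j ∈ Finset.range (I.horizon ε), I.duration ε j * ((I.premature ε F j).card : ℝ) ≤
      1 / (2 * ε) * I.excess ε F := by
    refine (I.premature_le hε hF).trans (mul_le_mul_of_nonneg_left ?_ (by positivity))
    rw [excess_eq hε hF.1]
    refine (Finset.sum_le_sum fun j hj => mul_le_mul_of_nonneg_left ?_
      (I.duration_pos hε (Finset.mem_range.1 hj)).le).trans (le_add_of_nonneg_left hslack)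
    calc ∑ B ∈ I.budgetActive (I.state ε j), (crossings F B : ℝ)
        = ∑ B ∈ I.budgetActive (I.state ε j), (I.surplus ε F j B : ℝ) := by
          refine Finset.sum_congr rfl fun B hB => ?_
          rw [surplus, if_neg (Finset.disjoint_right.1 (disjoint_demandActive_budgetActive _) hB)]
      _ ≤ _ := Finset.sum_le_sum_of_subset_of_nonneg Finset.subset_union_right
          fun _ _ _ => Nat.cast_nonneg _
  have hphase : ∀ j ∈ Finset.range (I.horizon ε),
      I.duration ε j * ((I.demandActive (I.state ε j)).card : ℝ) ≤
      I.duration ε j * ((I.premature ε F j).card : ℝ) +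
      10 / 3 * (I.duration ε j * (2 * (((I.active (I.state ε j)).card : ℝ) -
        mergedCount (I.active (I.state ε j)) ((components F).image (I.late ε))))) -
      10 / 3 * (I.duration ε j *
        ((∑ A ∈ I.active (I.state ε j), ∑ T ∈ components F, crossings (R T) A : ℕ) : ℝ)) +
      2 * (I.duration ε j * (((I.active (I.state ε j)).filter fun A =>
        ∃ P ∈ 𝒲.image fun T => ({A₀ T, B₀ T} : Finset (Finset V)), ∃ B ∈ P, I.sep B = I.sep A).card : ℝ)) -
      I.duration ε j *
        ((∑ A ∈ I.active (I.state ε j), ∑ T ∈ 𝒲, crossings (Q T) A : ℕ) : ℝ) +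
      17 * (I.duration ε j * ∑ A ∈ I.active (I.state ε j), (I.surplus ε F j A : ℝ)) := by
    intro j hj
    have h1 := h.phase_inequality hF.1 j
    have h2 := card_demandActive_le (I := I) (ε := ε) F j
    have h3 := mergedCount_late_le (I := I) (ε := ε) F j
    have h4 : ((I.active (I.state ε j)).filter fun A => ∃ T ∈ 𝒲, I.sep A = I.sep (A₀ T)).card ≤
        ((I.active (I.state ε j)).filter fun A =>
          ∃ P ∈ 𝒲.image fun T => ({A₀ T, B₀ T} : Finset (Finset V)), ∃ B ∈ P, I.sep B = I.sep A).card := by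
      refine Finset.card_le_card (Finset.monotone_filter_right _ ?_)
      rintro A - ⟨T, hT, hA⟩
      exact ⟨_, Finset.mem_image_of_mem _ hT, A₀ T, Finset.mem_insert_self _ _, hA.symm⟩
    have hpos := (I.duration_pos hε (Finset.mem_range.1 hj)).le
    rw [← Nat.cast_sum]
    rify at h1 h2 h3 h4
    push_cast
    refine le_of_le_of_eq (mul_le_mul_of_nonneg_left (?_ :
      _ ≤ ((I.premature ε F j).card : ℝ) + 10 / 3 * (2 * (((I.active (I.state ε j)).card : ℝ) -
        mergedCount (I.active (I.state ε j)) ((components F).image (I.late ε)))) -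
      10 / 3 * ∑ A ∈ I.active (I.state ε j), ∑ T ∈ components F, (crossings (R T) A : ℝ) +
      2 * (((I.active (I.state ε j)).filter fun A =>
        ∃ P ∈ 𝒲.image fun T => ({A₀ T, B₀ T} : Finset (Finset V)), ∃ B ∈ P, I.sep B = I.sep A).card : ℝ) -
      ∑ A ∈ I.active (I.state ε j), ∑ T ∈ 𝒲, (crossings (Q T) A : ℝ) +
      17 * ∑ A ∈ I.active (I.state ε j), (I.surplus ε F j A : ℝ)) hpos) (by ring)
    -- The phase inequality divided by 3, with `L = 20 / 3 * L - 17 / 3 * L` and the first part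
    -- bounded through the gain.
    linarith
  have hsum := Finset.sum_le_sum hphase
  simp only [Finset.sum_add_distrib, Finset.sum_sub_distrib, ← Finset.mul_sum] at hsum
  rw [I.sepValue_eq hε, I.gain_eq hε hF.1, coverage_eq hε hF.1, add_mul]
  -- The connectors use `10 / 3 + 1` copies of the slack, while `17 * excess` contains 17.
  have hexc := excess_eq hε hF.1
  linarith

theorem exists_collections (hε : 0 < ε) {F : Finset (Sym2 V)} (hF : I.IsOptimal F) [Nonempty V] :
    ∃ (𝒮 : Finset (Finset V)) (𝒬 : Finset (Finset (Finset V))),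
      (∀ S ∈ 𝒮, I.ActivelyConnectedSet ε S) ∧ I.IsAutarkicCollection ε 𝒬 ∧ I.CrossingFree 𝒬 ∧
      ∀ rep : Finset (Finset V) → Sym2 (Finset V) → Sym2 V, I.IsRepresentative 𝒬 rep →
        I.sepValue ε ≤ 10 / 3 * (I.gain ε 𝒮 - I.collectionCost 𝒮) +
            (2 * I.coverage ε 𝒬 - I.connectorCost rep 𝒬) +
            (1 / (2 * ε) + 17) * I.excess ε F := by
  let 𝒲 := (components F).filter fun T => ∃ j A B, I.CleanPair ε F j T A B
  have h𝒲 : 𝒲 ⊆ components F := Finset.filter_subset _ _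
  have hpair : ∀ T, ∃ k A B, T ∈ 𝒲 → I.CleanPair ε F k T A B := by
    intro T
    by_cases hT : T ∈ 𝒲
    · obtain ⟨k, A, B, h⟩ := (Finset.mem_filter.1 hT).2
      exact ⟨k, A, B, fun _ => h⟩
    · exact ⟨0, ∅, ∅, fun h => absurd h hT⟩
  choose k₀ A₀ B₀ hpair using hpair
  refine ⟨(components F).image (I.late ε), 𝒲.image fun T => {A₀ T, B₀ T}, ?_, ?_,
    crossingFree_pairs hF.1 h𝒲 hpair, fun rep hrep => ?_⟩
  · intro S hS
    obtain ⟨T, hT, rfl⟩ := Finset.mem_image.1 hS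
    exact activelyConnectedSet_late hε hF.1 (nonempty_of_mem_components hT)
  · intro P hP
    obtain ⟨T, hT, rfl⟩ := Finset.mem_image.1 hP
    exact Or.inl ((hpair T hT).isAutarkicPair hε hF.1)
  · obtain ⟨a, b, R, Q, hdata, hR, hQ⟩ := exists_connectorData hF.1 h𝒲 hpair
      (fun T hT hTW hex => hTW (Finset.mem_filter.2 ⟨hT, hex⟩)) hrep
    have h1 := hdata.main_inequality hε hF
    have h2 := (collectionCost_image_le (I := I) (components F) (I.late ε)).trans
      (Finset.sum_le_sum hR)
    have h3 := (connectorCost_image_le (I := I) 𝒲 (fun T => {A₀ T, B₀ T}) rep).trans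
      (Finset.sum_le_sum hQ)
    linarith

theorem exists_collections_of_isEmpty (hε : 0 < ε) {F : Finset (Sym2 V)} (hF : I.IsOptimal F)
    [IsEmpty V] (rep : Finset (Finset V) → Sym2 (Finset V) → Sym2 V) :
    I.sepValue ε ≤ 10 / 3 * (I.gain ε ∅ - I.collectionCost ∅) +
      (2 * I.coverage ε ∅ - I.connectorCost rep ∅) + (1 / (2 * ε) + 17) * I.excess ε F := by
  have hcomps : ∀ j, I.comps (I.state ε j) = ∅ := fun j => by
    rw [comps, components, Finset.univ_eq_empty, Finset.image_empty]
  have hact : ∀ j, I.active (I.state ε j) = ∅ := fun j =>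
    Finset.subset_empty.1 (hcomps j ▸ active_subset _)
  have hdem : ∀ j, I.demandActive (I.state ε j) = ∅ := fun j =>
    Finset.subset_empty.1 (hcomps j ▸ demandActive_subset _)
  have hexc : 0 ≤ I.excess ε F := by
    rw [excess_eq hε hF.1]
    simpa [hact] using Finset.sum_nonneg fun e he => I.slack_nonneg hε (hF.1.1 he)
  rw [I.sepValue_eq hε, I.gain_eq hε hF.1, coverage_eq hε hF.1]
  simp only [hact, hdem, mergedCount_empty, collectionCost, connectorCost]
  have : 0 ≤ (1 / (2 * ε) + 17) * I.excess ε F := by positivity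
  simpa using this

end

end

end SteinerForestInstance

theorem mainTheorem2 {V : Type*} [Fintype V] (I : SteinerForestInstance V)
    (ε : ℝ) (hε : 0 < ε) (OPT : Finset (Sym2 V)) (hOPT : I.IsOptimal OPT) :
    ∃ (𝒮 : Finset (Finset V)) (𝒬 : Finset (Finset (Finset V))),
      (∀ S ∈ 𝒮, I.ActivelyConnectedSet ε S) ∧
      I.IsAutarkicCollection ε 𝒬 ∧
      I.CrossingFree 𝒬 ∧
      ∀ rep : Finset (Finset V) → Sym2 (Finset V) → Sym2 V, I.IsRepresentative 𝒬 rep →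
        I.sepValue ε ≤
          10 / 3 * (I.gain ε 𝒮 - I.collectionCost 𝒮) +
            (2 * I.coverage ε 𝒬 - I.connectorCost rep 𝒬) +
            (1 / (2 * ε) + 17) * I.excess ε OPT := by
  rcases isEmpty_or_nonempty V with hV | hV
  · exact ⟨∅, ∅, by simp, by simp [SteinerForestInstance.IsAutarkicCollection], by simp [SteinerForestInstance.CrossingFree],
      fun rep _ => SteinerForestInstance.exists_collections_of_isEmpty hε hOPT rep⟩
  · exact SteinerForestInstance.exists_collections hε hOPT
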